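/- Let $\Sigma=S^2$ and let $\{g(t)\}_{t\in[0,1]}$ be a smooth path of smooth Riemannian metrics on $\Sigma$ (smooth jointly in $t$ and the point) such that, for all $t\in[0,1]$, the Gauss curvature satisfies $K(g(t))>0$ and $\mathrm{tr}_{g(t)}\,g'(t)=0$. Let $r_o>0$ be given by $|\Sigma|_{g(t)}=4\pi r_o^2$ (this area does not depend on $t$; it suffices to take $t=0$), and put $$\beta=\min_{t\in[0,1],\,x\in\Sigma} r_o^2\,K(g(t))(x),\qquad \alpha=\max_{t\in[0,1],\,x\in\Sigma}\tfrac14\,|g'|_g^2(t,x).$$ Suppose $\alpha>0$, i.e. the path is not constant. Let $m\le \tfrac12 r_o$ and $k\ge 0$ be constants such that $$\beta-\Big[1+\big(1-\tfrac{2m}{r_o}\big)\alpha\Big]k^2>0\ \text{ if } m<0,\qquad \beta-(1+\alpha)k^2>0\ \text{ if } m\ge 0,$$ and let $$A_o=r_o\left[\frac{\alpha}{\beta-\big[1+(1-\frac{2m}{r_o})\alpha\big]k^2}\right]^{1/2}\ \text{ if } m<0,\qquad A_o=r_o\left[\frac{\alpha}{\beta-(1+\alpha)k^2}\right]^{1/2}\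 \text{ if } m\ge 0.$$ For $s\ge 0$ let $u_m(s)=r$ be the number $r\ge r_o$ determined by $s=\int_{r_o}^{r}\big(1-\tfrac{2m}{\rho}\big)^{-1/2}\,d\rho$. Then, for every constant $A\ge A_o$, $$\gamma=A^2\,dt^2+r_o^{-2}\,u_m(Akt)^2\,g(t)$$ is a smooth Riemannian metric on $N=[0,1]\times\Sigma$ (up to the boundary). Write $\Sigma_t=\{t\}\times\Sigma$, let the mean curvature of $\Sigma_t$ in $(N,\gamma)$ be the trace of its second fundamental form $\langle\nabla_X\nu,Y\rangle$ for the unit normal $\nu$ pointing in the direction of increasing $t$, and let $$\mathfrak m_H(\Sigma_t)=\sqrt{\frac{|\Sigma_t|}{16\pi}}\left[1-\frac1{16\pi}\int_{\Sigma_t}H^2\,d\sigma\right]$$ be its Hawking mass, where $H$ is the mean curvature and $|\Sigma_t|$, $d\sigma$ are the area and the area element of the induced metric. Then: (i) the scalar curvature satisfies $R(\gamma)\ge 0$ on $N$; (ii) the metric induced on $\Sigma_0$ is $g(0)$, and $\Sigma_0$ has constant mean curvature $2k\,r_o^{-1}\big(1-\tfrac{2m}{r_o}\big)^{1/2}$;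 (iii) for each $t\in[0,1]$ the slice $\Sigma_t$ has constant mean curvature, which is positive if $k>0$ and either $m<\tfrac12 r_o$ or $t>0$; and $$\mathfrak m_H(\Sigma_t)=\tfrac12\,[\,u_m(Akt)-r_o\,](1-k^2)+\mathfrak m_H(\Sigma_0).$$ -/

import Mathlib

open Set MeasureTheory Bundle
open scoped Manifold ContDiff

noncomputable section

namespace Collar

/-! ### Bilinear forms on a vector space with a basis -/

section LinearAlgebra

variable {ι V : Type*} [Fintype ι] [DecidableEq ι] [AddCommGroup V] [Module ℝ V]

/-- The matrix `B (b i) (b j)` of a bilinear form in the basis `b`. -/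
def gram (b : Module.Basis ι ℝ V) (B : V → V → ℝ) : Matrix ι ι ℝ :=
  Matrix.of fun i j => B (b i) (b j)

/-- The trace `q^{ij} B_{ij}` of `B` with respect to the inner product `q`. -/
def traceWrt (b : Module.Basis ι ℝ V) (q B : V → V → ℝ) : ℝ :=
  ∑ i, ∑ j, (gram b q)⁻¹ i j * gram b B i j

/-- The squared norm `q^{ik} q^{jl} B_{ij} B_{kl}` of `B` with respect to the inner product `q`. -/
def normSqWrt (b : Module.Basis ι ℝ V) (q B : V → V → ℝ) : ℝ :=
  ∑ i, ∑ j, ∑ k, ∑ l,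
    (gram b q)⁻¹ i k * (gram b q)⁻¹ j l * gram b B i j * gram b B k l

end LinearAlgebra

/-! ### Curvature in charts, on a manifold possibly with boundary -/

section Curvature

variable {E H M ι : Type*} [NormedAddCommGroup E] [NormedSpace ℝ E] [TopologicalSpace H]
  [TopologicalSpace M] [ChartedSpace H M] [Fintype ι] [DecidableEq ι]

/-- The coordinate expression `G_{ij} = g(∂_i, ∂_j)` of a field `g` of bilinear forms in the
preferred chart at `x₀`, where `∂_i` is the coordinate vector field of the basis vector `b i` of
the model space. On a manifold with boundary, chart images lie in `range I` and all coordinate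
derivatives below are taken within `range I`. -/
def coordMetric (I : ModelWithCorners ℝ E H) (b : Module.Basis ι ℝ E)
    (g : ∀ x : M, TangentSpace I x → TangentSpace I x → ℝ) (x₀ : M) (y : E) : Matrix ι ι ℝ :=
  Matrix.of fun i j =>
    g ((extChartAt I x₀).symm y)
      (mfderivWithin 𝓘(ℝ, E) I (extChartAt I x₀).symm (range I) y (b i))
      (mfderivWithin 𝓘(ℝ, E) I (extChartAt I x₀).symm (range I) y (b j))

/-- The partial derivative `∂_i f` of a function of the coordinates. -/
def pd (I : ModelWithCorners ℝ E H) (b : Module.Basis ι ℝ E) (i : ι) (f : E → ℝ) (y : E) : ℝ :=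
  fderivWithin ℝ f (range I) y (b i)

/-- The Christoffel symbols
`Γ^k_{ij} = ½ G^{kl} (∂_i G_{jl} + ∂_j G_{il} - ∂_l G_{ij})` of a coordinate metric `G`. -/
def christoffel (I : ModelWithCorners ℝ E H) (b : Module.Basis ι ℝ E) (G : E → Matrix ι ι ℝ)
    (k i j : ι) (y : E) : ℝ :=
  (1 / 2) * ∑ l, (G y)⁻¹ k l *
    (pd I b i (fun z => G z j l) y + pd I b j (fun z => G z i l) y
      - pd I b l (fun z => G z i j) y)

/-- The component `R_{ijk}^l` of the curvature tensor: `R(∂_i, ∂_j) ∂_k = R_{ijk}^l ∂_l`, with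
`R(X, Y) Z = ∇_X ∇_Y Z - ∇_Y ∇_X Z - ∇_{[X, Y]} Z`. -/
def riemann (I : ModelWithCorners ℝ E H) (b : Module.Basis ι ℝ E) (G : E → Matrix ι ι ℝ)
    (i j k l : ι) (y : E) : ℝ :=
  pd I b i (christoffel I b G l j k) y - pd I b j (christoffel I b G l i k) y
    + ∑ m, (christoffel I b G l i m y * christoffel I b G m j k y
      - christoffel I b G l j m y * christoffel I b G m i k y)

/-- The scalar curvature `G^{jk} R_{ijk}^i` at `x`, computed in the preferred chart at `x`. -/
def scalarCurvature (I : ModelWithCorners ℝ E H) (b : Module.Basis ι ℝ E)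
    (g : ∀ x : M, TangentSpace I x → TangentSpace I x → ℝ) (x : M) : ℝ :=
  let G := coordMetric I b g x
  let y := extChartAt I x x
  ∑ j, ∑ k, (G y)⁻¹ j k * ∑ i, riemann I b G i j k i y

/-- The Gauss curvature of a surface at `x`: the sectional curvature
`⟨R(∂_0, ∂_1) ∂_1, ∂_0⟩ / (G_{00} G_{11} - G_{01}²)` of its tangent plane. -/
def gaussCurvature (I : ModelWithCorners ℝ E H) (b : Module.Basis (Fin 2) ℝ E)
    (g : ∀ x : M, TangentSpace I x → TangentSpace I x → ℝ) (x : M) : ℝ :=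
  let G := coordMetric I b g x
  let y := extChartAt I x x
  (∑ l, G y l 0 * riemann I b G 0 1 1 l y) / (G y 0 0 * G y 1 1 - G y 0 1 ^ 2)

end Curvature

/-! ### The sphere `S²` and the cylinder `[0,1] × S²` -/

abbrev E₁ := EuclideanSpace ℝ (Fin 1)

abbrev E₂ := EuclideanSpace ℝ (Fin 2)

abbrev E₃ := EuclideanSpace ℝ (Fin 3)

/-- `S²`, as the unit sphere of `ℝ³` with its standard smooth structure. -/
abbrev S2 := Metric.sphere (0 : E₃) 1

instance : Fact (Module.finrank ℝ E₃ = 2 + 1) := ⟨by simp⟩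

/-- `N = [0,1] × S²`, a manifold with boundary. -/
abbrev N := Icc (0 : ℝ) 1 × S2

/-- The model with corners of `N`. -/
abbrev modelN := (𝓡∂ 1).prod (𝓡 2)

/-- The standard basis of `ℝ²`. -/
abbrev basisS : Module.Basis (Fin 2) ℝ E₂ := (EuclideanSpace.basisFun (Fin 2) ℝ).toBasis

/-- The standard basis of `ℝ × ℝ²`. -/
abbrev basisN : Module.Basis (Fin 1 ⊕ Fin 2) ℝ (E₁ × E₂) :=
  ((EuclideanSpace.basisFun (Fin 1) ℝ).toBasis).prod basisS

/-- Smooth Riemannian metrics on `S²`. -/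
abbrev SphereMetric :=
  ContMDiffRiemannianMetric (𝓡 2) ∞ E₂ (fun x : S2 => TangentSpace (𝓡 2) x)

/-- Smooth Riemannian metrics on `N`, smooth up to the boundary. -/
abbrev CylinderMetric :=
  ContMDiffRiemannianMetric modelN ∞ (E₁ × E₂) (fun p : N => TangentSpace modelN p)

/-- Fields of bilinear forms on `S²`. -/
abbrev SphereForm := ∀ x : S2, TangentSpace (𝓡 2) x → TangentSpace (𝓡 2) x → ℝ

/-- Fields of bilinear forms on `N`. -/
abbrev CylinderForm := ∀ p : N, TangentSpace modelN p → TangentSpace modelN p → ℝ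

/-- The bilinear form field underlying a metric on `S²`. -/
abbrev sphereForm (g : SphereMetric) : SphereForm := fun x v w => g.inner x v w

/-- The bilinear form field underlying a metric on `N`. -/
abbrev cylinderForm (γ : CylinderMetric) : CylinderForm := fun p v w => γ.inner p v w

/-- The round metric `g_*` on `S²`, induced from `ℝ³`; its area is `4π`. -/
def roundForm : SphereForm := fun x v w =>
  let dι : TangentSpace (𝓡 2) x → E₃ := fun z =>
    mfderiv (𝓡 2) 𝓘(ℝ, E₃) (Subtype.val : S2 → E₃) x z
  inner ℝ (dι v) (dι w)

/-- The area measure `dσ_h` of a metric `h` on `S²`. In local coordinates it is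
`√(det h_{ij}) dx¹ dx²`; equivalently its density with respect to the area measure of the round
metric `g_*` (the surface measure `toSphere`, of total mass `4π`) is
`√(det h_{ij} / det (g_*)_{ij})`, in any basis of the tangent plane. -/
def areaMeasure (h : SphereForm) : Measure S2 :=
  (volume : Measure E₃).toSphere.withDensity fun x =>
    ENNReal.ofReal (Real.sqrt
      ((gram basisS (fun v w : E₂ => h x v w)).det /
        (gram basisS (fun v w : E₂ => roundForm x v w)).det))

/-- The area `|S²|_h`. -/
def area (h : SphereForm) : ℝ := (areaMeasure h).real univ

/-- The area radius: `|S²|_h = 4 π r²`. -/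
def areaRadius (h : SphereForm) : ℝ := Real.sqrt (area h / (4 * Real.pi))

/-! ### Paths of metrics on `S²` -/

/-- Smoothness of the path `g(t)`, `t ∈ [0,1]`, jointly in `t` and the point of `S²`.
The values of `g` outside `[0,1]` play no role. -/
def IsSmoothPath (g : ℝ → SphereMetric) : Prop :=
  ContMDiffOn (𝓘(ℝ, ℝ).prod (𝓡 2)) ((𝓡 2).prod 𝓘(ℝ, E₂ →L[ℝ] E₂ →L[ℝ] ℝ)) ∞
    (fun p : ℝ × S2 => (TotalSpace.mk' (E₂ →L[ℝ] E₂ →L[ℝ] ℝ) p.2 ((g p.1).inner p.2) :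
      TotalSpace (E₂ →L[ℝ] E₂ →L[ℝ] ℝ)
        (fun x : S2 => TangentSpace (𝓡 2) x →L[ℝ] TangentSpace (𝓡 2) x →L[ℝ] ℝ)))
    (Icc 0 1 ×ˢ univ)

/-- `g'(t)`; one-sided at `t = 0, 1`. -/
def velocity (g : ℝ → SphereMetric) (t : ℝ) : SphereForm := fun x v w =>
  derivWithin (fun s => (g s).inner x v w) (Icc 0 1) t

/-- `tr_{g(t)} g'(t)` at `x`. -/
def traceVelocity (g : ℝ → SphereMetric) (t : ℝ) (x : S2) : ℝ :=
  traceWrt basisS (fun v w : E₂ => (g t).inner x v w) (fun v w : E₂ => velocity g t x v w)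

/-- `|g'(t)|²_{g(t)}` at `x`. -/
def normSqVelocity (g : ℝ → SphereMetric) (t : ℝ) (x : S2) : ℝ :=
  normSqWrt basisS (fun v w : E₂ => (g t).inner x v w) (fun v w : E₂ => velocity g t x v w)

/-- `β = min r_o² K(g(t))(x)` over `[0,1] × S²`. -/
def pathBeta (g : ℝ → SphereMetric) (ro : ℝ) : ℝ :=
  ⨅ p : Icc (0 : ℝ) 1 × S2, ro ^ 2 * gaussCurvature (𝓡 2) basisS (sphereForm (g p.1)) p.2

/-- `α = max ¼ |g'|²_g (t, x)` over `[0,1] × S²`. -/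
def pathAlpha (g : ℝ → SphereMetric) : ℝ :=
  ⨆ p : Icc (0 : ℝ) 1 × S2, (1 / 4) * normSqVelocity g p.1 p.2

/-! ### The Schwarzschild profile `u_m` -/

/-- `s = ∫_{r_o}^r (1 - 2m/ρ)^{-1/2} dρ`, the distance to `{r = r_o}` in the spatial Schwarzschild
metric of mass `m`. -/
def schwarzschildArc (m ro r : ℝ) : ℝ :=
  ∫ ρ in ro..r, (Real.sqrt (1 - 2 * m / ρ))⁻¹

/-- `u_m(s)`, `s ≥ 0`: the radius `r ≥ r_o` as a function of the distance `s`. -/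
def uProfile (m ro : ℝ) : ℝ → ℝ := Function.invFunOn (schwarzschildArc m ro) (Ici ro)

/-- `A_o = r_o (α / (β - (1 + c α) k²))^{1/2}`, with `c = 1 - 2m/r_o` if `m < 0` and `c = 1` if
`m ≥ 0`. -/
def thresholdA (α β ro m k : ℝ) : ℝ :=
  if m < 0 then ro * Real.sqrt (α / (β - (1 + (1 - 2 * m / ro) * α) * k ^ 2))
  else ro * Real.sqrt (α / (β - (1 + α) * k ^ 2))

/-! ### The collar metric and its slices `Σ_t = {t} × S²` -/

/-- The function `t` on `N`. -/
def timeFn : N → ℝ := fun p => (p.1 : ℝ)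

/-- `A² dt² + r_o^{-2} u_m(Akt)² g(t)` on `N`. -/
def collarForm (g : ℝ → SphereMetric) (m ro k A : ℝ) : CylinderForm := fun p v w =>
  let dt : TangentSpace modelN p → ℝ := fun z => mfderiv modelN 𝓘(ℝ, ℝ) timeFn p z
  A ^ 2 * (dt v * dt w)
    + ro⁻¹ ^ 2 * uProfile m ro (A * k * (p.1 : ℝ)) ^ 2 *
      (g (p.1 : ℝ)).inner p.2 (mfderiv modelN (𝓡 2) (Prod.snd : N → S2) p v)
        (mfderiv modelN (𝓡 2) (Prod.snd : N → S2) p w)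

/-- The metric induced on `Σ_t`: the pull-back of `γ` under `x ↦ (t, x)`. -/
def inducedForm (γ : CylinderForm) (t : Icc (0 : ℝ) 1) : SphereForm := fun x v w =>
  γ (t, x) (mfderiv (𝓡 2) modelN (fun x : S2 => ((t, x) : N)) x v)
    (mfderiv (𝓡 2) modelN (fun x : S2 => ((t, x) : N)) x w)

/-- The components in the preferred chart at `p` of the gradient of `t`. -/
def gradTime (γ : CylinderForm) (p : N) (i : Fin 1 ⊕ Fin 2) (y : E₁ × E₂) : ℝ :=
  ∑ j, (coordMetric modelN basisN γ p y)⁻¹ i j *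
    pd modelN basisN j (fun z => timeFn ((extChartAt modelN p).symm z)) y

/-- The components in the preferred chart at `p` of the field `ν = ∇t / |∇t|` of unit normals to
the slices, pointing in the direction of increasing `t`. -/
def unitNormal (γ : CylinderForm) (p : N) (i : Fin 1 ⊕ Fin 2) (y : E₁ × E₂) : ℝ :=
  gradTime γ p i y / Real.sqrt
    (∑ k, ∑ l, coordMetric modelN basisN γ p y k l * gradTime γ p k y * gradTime γ p l y)

/-- The second fundamental form `II(∂_a, ∂_b) = ⟨∇_{∂_a} ν, ∂_b⟩` at `p = (t, x)` of `Σ_t`.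
The charts of `N` are products, so the coordinate fields `∂_a`, `a : Fin 2`, of the second factor
span the tangent planes of the slices. -/
def secondFundamentalForm (γ : CylinderForm) (p : N) : Matrix (Fin 2) (Fin 2) ℝ :=
  let G := coordMetric modelN basisN γ p
  let y := extChartAt modelN p p
  Matrix.of fun a b => ∑ i, G y i (Sum.inr b) *
    (pd modelN basisN (Sum.inr a) (unitNormal γ p i) y
      + ∑ j, christoffel modelN basisN G i (Sum.inr a) j y * unitNormal γ p j y)

/-- The mean curvature of `Σ_t` at `p = (t, x)`: the trace of the second fundamental form with
respect to the induced metric. Round spheres in `ℝ³` have positive mean curvature with respect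
to the outward normal. -/
def meanCurvature (γ : CylinderForm) (p : N) : ℝ :=
  let G := coordMetric modelN basisN γ p (extChartAt modelN p p)
  ∑ a, ∑ b, (G.submatrix Sum.inr Sum.inr)⁻¹ a b * secondFundamentalForm γ p a b

/-- The Hawking mass `√(|Σ_t| / 16π) (1 - (1/16π) ∫_{Σ_t} H² dσ)` of `Σ_t` in `(N, γ)`. -/
def hawkingMass (γ : CylinderForm) (t : Icc (0 : ℝ) 1) : ℝ :=
  Real.sqrt (area (inducedForm γ t) / (16 * Real.pi)) *
    (1 - 1 / (16 * Real.pi) *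
      ∫ x, meanCurvature γ (t, x) ^ 2 ∂(areaMeasure (inducedForm γ t)))

end Collar

end

/-! In coordinates the collar is a block metric A² dt² + P(t, x). Two things make it tractable: the
scalar curvature formula for such a block, and the fact that u = u_m solves a closed first order
system, u' = v, v' = m / u², with v² = 1 - 2m/u.

`sum_riemann_block` is the Gauss equation combined with the variation of the second fundamental
form: R(γ) = R(P) - A⁻² (τ' + ¼ |P'|² + ¼ τ²), with τ = tr_P P'. Here P is (u/r_o)² g(t), with u
evaluated at Akt. The factor is constant on each slice, so R(P) is 2K rescaled by (r_o/u)². Since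
tr_g g' = 0, the conformal and trace free parts of P' are orthogonal: τ = 4Ak v/u and |P'|² = ½ τ² +
|g'|². On substituting the system for u every term containing m cancels (`scalarCurvature_collar`):
R(γ) = (2/u²) (r_o² K - k² - u² |g'|² / (8A²)).

Only an upper bound on u is then needed. With L = `slopeBound` bounding u', u ≤ r_o + LAk, hence u²
≤ 2r_o² + 2L²A²k². As r_o² K ≥ β and |g'|² ≤ 4α, it suffices that α (r_o²/A² + L²k²) ≤ β - k².
Solving for A gives exactly A ≥ A_o; the two cases in A_o are L² = 1 - 2m/r_o for m < 0 and L = 1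
for m ≥ 0 (`threshold_estimate`, `curvature_estimate`).

The unit normal is A⁻¹ ∂_t, so H = τ / (2A) = 2kv/u is constant on slices (`meanCurvature_collar`).
Trace freeness also freezes the area density of g(t) (`gram_det_const`), so |Σ_t| = 4πu². Therefore
the Hawking mass is ½u (1 - k²v²) = ½u (1 - k²) + k²m, an affine function of u, which is the last
claim (`hawkingMass_collar`).

The delicate analytic point is smoothness of u at s = 0 when m = r_o/2: the arc length integrand is
singular there and v(0) = 0, so the inverse function theorem does not reach the endpoint. The system
itself stays regular, and smoothness is bootstrapped from it (`contDiffOn_uProfile_uSpeed`). -/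

noncomputable section

namespace Collar

/-! ### The Schwarzschild profile -/

section Profile

open Filter Topology

variable {m ro : ℝ}

/-- An upper bound for `u_m'`. -/
def slopeBound (m ro : ℝ) : ℝ := if m < 0 then Real.sqrt (1 - 2 * m / ro) else 1

lemma slopeBound_pos (hro : 0 < ro) : 0 < slopeBound m ro := by
  unfold slopeBound
  split_ifs with h
  · apply Real.sqrt_pos.2
    have : m / ro ≤ 0 := div_nonpos_of_nonpos_of_nonneg h.le hro.le
    rw [mul_div_assoc]; linarith
  · exact one_pos

lemma one_sub_pos (hro : 0 < ro) (hm : m ≤ ro / 2) {r : ℝ} (hr : ro < r) :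
    0 < 1 - 2 * m / r := by
  have hr0 : 0 < r := hro.trans hr
  rw [sub_pos, div_lt_one hr0]; linarith

lemma one_sub_nonneg (hro : 0 < ro) (hm : m ≤ ro / 2) {r : ℝ} (hr : ro ≤ r) :
    0 ≤ 1 - 2 * m / r := by
  have hr0 : 0 < r := hro.trans_le hr
  rw [sub_nonneg, div_le_one hr0]; linarith

lemma sqrt_le_slopeBound (hro : 0 < ro) {r : ℝ} (hr : ro ≤ r) :
    Real.sqrt (1 - 2 * m / r) ≤ slopeBound m ro := by
  have hr0 : 0 < r := hro.trans_le hr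
  unfold slopeBound
  split_ifs with h
  · apply Real.sqrt_le_sqrt
    have : 2 * m / ro ≤ 2 * m / r := by
      rw [div_le_div_iff₀ hro hr0]; nlinarith
    linarith
  · have : 0 ≤ 2 * m / r := div_nonneg (by linarith) hr0.le
    exact Real.sqrt_le_iff.2 ⟨zero_le_one, by linarith⟩

/-- In the extreme case m = r_o/2 the integrand blows up at r_o. Since 1 - 2m/ρ ≥ (ρ - r_o)/ρ, it is
dominated by a multiple of (ρ - r_o)^(-1/2), which is integrable. -/
lemma intervalIntegrable_arc (hro : 0 < ro) (hm : m ≤ ro / 2) {a b : ℝ} (ha : ro ≤ a)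
    (hb : ro ≤ b) :
    IntervalIntegrable (fun ρ => (Real.sqrt (1 - 2 * m / ρ))⁻¹) volume a b := by
  set M := max a b
  have key : IntervalIntegrable (fun ρ : ℝ => Real.sqrt M * (ρ - ro) ^ (-(1 / 2) : ℝ))
      volume a b := by
    apply IntervalIntegrable.const_mul
    have := (intervalIntegral.intervalIntegrable_rpow' (a := a - ro) (b := b - ro)
      (r := -(1 / 2)) (by norm_num)).comp_sub_right ro
    simpa using this
  refine key.mono_fun' (by fun_prop) ?_
  rw [Filter.EventuallyLE, ae_restrict_iff' measurableSet_uIoc]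
  refine Eventually.of_forall fun ρ hρ => ?_
  have h1 : ro < ρ := (le_min ha hb).trans_lt hρ.1
  have h2 : ρ ≤ M := hρ.2
  have h0 : 0 < ρ := hro.trans h1
  have h3 : 0 < ρ - ro := sub_pos.2 h1
  rw [Real.norm_of_nonneg (by positivity), Real.rpow_neg h3.le, ← Real.sqrt_eq_rpow,
    inv_eq_one_div, ← div_eq_mul_inv, div_le_div_iff₀ (Real.sqrt_pos.2 (one_sub_pos hro hm h1))
      (Real.sqrt_pos.2 h3), one_mul, ← Real.sqrt_mul (h0.le.trans h2)]
  apply Real.sqrt_le_sqrt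
  have : ρ * (1 - 2 * m / ρ) = ρ - 2 * m := by field_simp
  nlinarith [one_sub_pos hro hm h1]

/-- The integrand is at least 1 / `slopeBound`. This one inequality yields injectivity and
surjectivity of the arc length and the Lipschitz bound for u. -/
lemma arc_sub (hro : 0 < ro) (hm : m ≤ ro / 2) {a b : ℝ} (ha : ro ≤ a) (hab : a ≤ b) :
    b - a ≤ slopeBound m ro * (schwarzschildArc m ro b - schwarzschildArc m ro a) := by
  have hL := slopeBound_pos (m := m) hro
  have e : schwarzschildArc m ro b - schwarzschildArc m ro a
      = ∫ ρ in a..b, (Real.sqrt (1 - 2 * m / ρ))⁻¹ :=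
    intervalIntegral.integral_interval_sub_left
      (intervalIntegrable_arc hro hm le_rfl (ha.trans hab)) (intervalIntegrable_arc hro hm le_rfl ha)
  have : ∫ _ in a..b, (slopeBound m ro)⁻¹ ≤ ∫ ρ in a..b, (Real.sqrt (1 - 2 * m / ρ))⁻¹ := by
    refine intervalIntegral.integral_mono_on_of_le_Ioo hab (by simp)
      (intervalIntegrable_arc hro hm ha (ha.trans hab)) fun ρ hρ => ?_
    have h1 : ro < ρ := ha.trans_lt hρ.1
    exact inv_anti₀ (Real.sqrt_pos.2 (one_sub_pos hro hm h1)) (sqrt_le_slopeBound hro h1.le)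
  rw [e]
  rw [intervalIntegral.integral_const, smul_eq_mul, ← div_eq_mul_inv, div_le_iff₀ hL] at this
  linarith

lemma arc_strictMonoOn (hro : 0 < ro) (hm : m ≤ ro / 2) :
    StrictMonoOn (schwarzschildArc m ro) (Ici ro) := fun a ha b _ hab => by
  have := arc_sub hro hm ha hab.le
  have hL := slopeBound_pos (m := m) hro
  by_contra! h
  nlinarith [mul_nonneg hL.le (sub_nonneg.2 h)]

lemma arc_self : schwarzschildArc m ro ro = 0 := intervalIntegral.integral_same

lemma arc_continuousOn (hro : 0 < ro) (hm : m ≤ ro / 2) {b : ℝ} (hb : ro ≤ b) :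
    ContinuousOn (schwarzschildArc m ro) (Icc ro b) := by
  have := intervalIntegral.continuousOn_primitive_interval (a := ro) (b := b) (μ := volume)
    (f := fun ρ => (Real.sqrt (1 - 2 * m / ρ))⁻¹)
    (by
      rw [uIcc_of_le hb, ← intervalIntegrable_iff_integrableOn_Icc_of_le hb]
      exact intervalIntegrable_arc hro hm le_rfl hb)
  rwa [uIcc_of_le hb] at this

lemma arc_surjOn (hro : 0 < ro) (hm : m ≤ ro / 2) :
    SurjOn (schwarzschildArc m ro) (Ici ro) (Ici 0) := fun s hs => by
  have hL := slopeBound_pos (m := m) hro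
  -- Arc length grows at rate at least 1 / `slopeBound`, so it has reached s by this radius.
  set b := ro + slopeBound m ro * s
  have hb : ro ≤ b := le_add_of_nonneg_right (mul_nonneg hL.le hs)
  have h := arc_sub hro hm le_rfl hb
  rw [arc_self] at h
  have h' : s ≤ schwarzschildArc m ro b := by
    have : slopeBound m ro * s ≤ slopeBound m ro * schwarzschildArc m ro b := by
      simpa [b] using h
    exact le_of_mul_le_mul_left this hL
  obtain ⟨r, hr, rfl⟩ := intermediate_value_Icc hb (arc_continuousOn hro hm hb)
    (show s ∈ _ from ⟨by rw [arc_self]; exact hs, h'⟩)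
  exact ⟨r, hr.1, rfl⟩

lemma uProfile_ge (hro : 0 < ro) (hm : m ≤ ro / 2) {s : ℝ} (hs : 0 ≤ s) : ro ≤ uProfile m ro s :=
  Function.invFunOn_mem (arc_surjOn hro hm hs)

lemma arc_uProfile (hro : 0 < ro) (hm : m ≤ ro / 2) {s : ℝ} (hs : 0 ≤ s) :
    schwarzschildArc m ro (uProfile m ro s) = s :=
  Function.invFunOn_eq (arc_surjOn hro hm hs)

lemma uProfile_zero (hro : 0 < ro) (hm : m ≤ ro / 2) : uProfile m ro 0 = ro :=
  (arc_strictMonoOn hro hm).injOn (uProfile_ge hro hm le_rfl) self_mem_Ici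
    (by rw [arc_uProfile hro hm le_rfl, arc_self])

lemma uProfile_strictMonoOn (hro : 0 < ro) (hm : m ≤ ro / 2) :
    StrictMonoOn (uProfile m ro) (Ici 0) := fun a ha b hb hab => by
  rw [← (arc_strictMonoOn hro hm).lt_iff_lt (uProfile_ge hro hm ha) (uProfile_ge hro hm hb),
    arc_uProfile hro hm ha, arc_uProfile hro hm hb]
  exact hab

lemma uProfile_gt (hro : 0 < ro) (hm : m ≤ ro / 2) {s : ℝ} (hs : 0 < s) : ro < uProfile m ro s := by
  have := uProfile_strictMonoOn hro hm self_mem_Ici hs.le hs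
  rwa [uProfile_zero hro hm] at this

lemma uProfile_sub_le (hro : 0 < ro) (hm : m ≤ ro / 2) {a b : ℝ} (ha : 0 ≤ a) (hab : a ≤ b) :
    uProfile m ro b - uProfile m ro a ≤ slopeBound m ro * (b - a) := by
  have := arc_sub hro hm (uProfile_ge hro hm ha)
    ((uProfile_strictMonoOn hro hm).monotoneOn ha (ha.trans hab) hab)
  rwa [arc_uProfile hro hm ha, arc_uProfile hro hm (ha.trans hab)] at this

lemma uProfile_le (hro : 0 < ro) (hm : m ≤ ro / 2) {s : ℝ} (hs : 0 ≤ s) :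
    uProfile m ro s ≤ ro + slopeBound m ro * s := by
  have := uProfile_sub_le hro hm le_rfl hs
  rw [uProfile_zero hro hm, sub_zero] at this
  linarith

lemma uProfile_continuousOn (hro : 0 < ro) (hm : m ≤ ro / 2) :
    ContinuousOn (uProfile m ro) (Ici 0) := by
  have hL := slopeBound_pos (m := m) hro
  refine (LipschitzOnWith.of_dist_le_mul (K := ⟨slopeBound m ro, hL.le⟩) ?_).continuousOn
  have key : ∀ a b, 0 ≤ a → a ≤ b →
      |uProfile m ro b - uProfile m ro a| ≤ slopeBound m ro * |b - a| := fun a b ha hab => by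
    rw [abs_of_nonneg (sub_nonneg.2
      ((uProfile_strictMonoOn hro hm).monotoneOn ha (ha.trans hab) hab)),
      abs_of_nonneg (sub_nonneg.2 hab)]
    exact uProfile_sub_le hro hm ha hab
  intro a ha b hb
  rw [Real.dist_eq, Real.dist_eq]
  rcases le_total a b with h | h
  · rw [abs_sub_comm, abs_sub_comm a b]; exact key a b ha h
  · exact key b a hb h

/-- The inequality r > r_o is strict because for m = r_o/2 the slope becomes infinite at r_o; the
endpoint is recovered later by passing to the limit in the derivative of the inverse. -/
lemma arc_hasDerivAt (hro : 0 < ro) (hm : m ≤ ro / 2) {r : ℝ} (hr : ro < r) :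
    HasDerivAt (schwarzschildArc m ro) (Real.sqrt (1 - 2 * m / r))⁻¹ r := by
  refine intervalIntegral.integral_hasDerivAt_right (intervalIntegrable_arc hro hm le_rfl hr.le)
    (Measurable.stronglyMeasurable (by fun_prop)).stronglyMeasurableAtFilter ?_
  have h1 : Real.sqrt (1 - 2 * m / r) ≠ 0 := (Real.sqrt_pos.2 (one_sub_pos hro hm hr)).ne'
  have h2 : r ≠ 0 := (hro.trans hr).ne'
  exact ContinuousAt.inv₀ (by fun_prop (disch := exact h2)) h1

lemma uProfile_hasDerivAt (hro : 0 < ro) (hm : m ≤ ro / 2) {s : ℝ} (hs : 0 < s) :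
    HasDerivAt (uProfile m ro) (Real.sqrt (1 - 2 * m / uProfile m ro s)) s := by
  have hu := uProfile_gt hro hm hs
  have h1 : (Real.sqrt (1 - 2 * m / uProfile m ro s))⁻¹ ≠ 0 :=
    inv_ne_zero (Real.sqrt_pos.2 (one_sub_pos hro hm hu)).ne'
  have := (arc_hasDerivAt hro hm hu).of_local_left_inverse
    ((uProfile_continuousOn hro hm).continuousAt (Ici_mem_nhds hs)) h1
    (by filter_upwards [Ici_mem_nhds hs] with z hz using arc_uProfile hro hm hz)
  rwa [inv_inv] at this

/-- The derivative of `u_m`. -/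
def uSpeed (m ro s : ℝ) : ℝ := Real.sqrt (1 - 2 * m / uProfile m ro s)

lemma uSpeed_continuousOn (hro : 0 < ro) (hm : m ≤ ro / 2) :
    ContinuousOn (uSpeed m ro) (Ici 0) := by
  have hu := uProfile_continuousOn hro hm
  have h0 : ∀ s ∈ Ici (0 : ℝ), uProfile m ro s ≠ 0 := fun s hs =>
    (hro.trans_le (uProfile_ge hro hm hs)).ne'
  unfold uSpeed
  fun_prop (disch := assumption)

/-- A derivative with a limit at the endpoint extends to a one-sided derivative there. This carries
the equations for u and v from s > 0 to s = 0, also when v(0) = 0. -/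
lemma hasDerivWithinAt_Ici_of_continuousOn {f f' : ℝ → ℝ} (hf : ContinuousOn f (Ici 0))
    (hf' : ContinuousOn f' (Ici 0)) (h : ∀ s, 0 < s → HasDerivAt f (f' s) s) {s : ℝ}
    (hs : 0 ≤ s) : HasDerivWithinAt f (f' s) (Ici 0) s := by
  rcases hs.eq_or_lt with rfl | hs
  · refine hasDerivWithinAt_Ici_of_tendsto_deriv (s := Ioi 0)
      (fun z hz => (h z hz).differentiableAt.differentiableWithinAt)
      ((hf 0 self_mem_Ici).mono Ioi_subset_Ici_self) self_mem_nhdsWithin ?_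
    refine ((hf' 0 self_mem_Ici).mono Ioi_subset_Ici_self).tendsto.congr' ?_
    filter_upwards [self_mem_nhdsWithin] with z hz using (h z hz).deriv.symm
  · exact (h s hs).hasDerivWithinAt

lemma uProfile_hasDerivWithinAt (hro : 0 < ro) (hm : m ≤ ro / 2) {s : ℝ} (hs : 0 ≤ s) :
    HasDerivWithinAt (uProfile m ro) (uSpeed m ro s) (Ici 0) s :=
  hasDerivWithinAt_Ici_of_continuousOn (uProfile_continuousOn hro hm) (uSpeed_continuousOn hro hm)
    (fun _ => uProfile_hasDerivAt hro hm) hs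

/-- Differentiating v² = 1 - 2m/u gives 2vv' = 2mu'/u², and u' = v cancels. The result has no
singularity where v vanishes. -/
lemma uSpeed_hasDerivWithinAt (hro : 0 < ro) (hm : m ≤ ro / 2) {s : ℝ} (hs : 0 ≤ s) :
    HasDerivWithinAt (uSpeed m ro) (m / uProfile m ro s ^ 2) (Ici 0) s := by
  have hu := uProfile_continuousOn hro hm
  have h0 : ∀ s ∈ Ici (0 : ℝ), uProfile m ro s ≠ 0 := fun s hs =>
    (hro.trans_le (uProfile_ge hro hm hs)).ne'
  refine hasDerivWithinAt_Ici_of_continuousOn (f' := fun s => m / uProfile m ro s ^ 2)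
    (uSpeed_continuousOn hro hm)
    (continuousOn_const.div (hu.pow 2) fun s hs => pow_ne_zero 2 (h0 s hs)) (fun s hs => ?_) hs
  have h1 := one_sub_pos hro hm (uProfile_gt hro hm hs)
  have h2 := h0 s hs.le
  have h3 := (Real.sqrt_pos.2 h1).ne'
  have h4 : HasDerivAt (fun z => 1 - 2 * m / uProfile m ro z) (2 * m *
      Real.sqrt (1 - 2 * m / uProfile m ro s) / uProfile m ro s ^ 2) s := by
    refine (((hasDerivAt_const s (2 * m)).fun_div (uProfile_hasDerivAt hro hm hs)
      h2).const_sub 1).congr_deriv ?_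
    ring
  refine (h4.sqrt h1.ne').congr_deriv ?_
  generalize Real.sqrt (1 - 2 * m / uProfile m ro s) = w at h3 ⊢
  field_simp

/-- Bootstrap for the closed system u' = v, v' = m/u²: both right-hand sides are as regular as (u,
v), since u ≥ r_o > 0. The two claims must be proved together. -/
lemma contDiffOn_uProfile_uSpeed (hro : 0 < ro) (hm : m ≤ ro / 2) (n : ℕ) :
    ContDiffOn ℝ n (uProfile m ro) (Ici 0) ∧ ContDiffOn ℝ n (uSpeed m ro) (Ici 0) := by
  induction n with
  | zero => simpa [contDiffOn_zero] using
      ⟨uProfile_continuousOn hro hm, uSpeed_continuousOn hro hm⟩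
  | succ n ih =>
    have h0 : ∀ s ∈ Ici (0 : ℝ), uProfile m ro s ≠ 0 := fun s hs =>
      (hro.trans_le (uProfile_ge hro hm hs)).ne'
    push_cast
    rw [contDiffOn_succ_iff_derivWithin (uniqueDiffOn_Ici 0),
      contDiffOn_succ_iff_derivWithin (uniqueDiffOn_Ici 0)]
    refine ⟨⟨fun s hs => (uProfile_hasDerivWithinAt hro hm hs).differentiableWithinAt, by simp,
      ih.2.congr fun s hs => (uProfile_hasDerivWithinAt hro hm hs).derivWithin
        (uniqueDiffOn_Ici 0 s hs)⟩,
      fun s hs => (uSpeed_hasDerivWithinAt hro hm hs).differentiableWithinAt, by simp, ?_⟩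
    refine ContDiffOn.congr (f := fun s => m / uProfile m ro s ^ 2) ?_ fun s hs =>
      (uSpeed_hasDerivWithinAt hro hm hs).derivWithin (uniqueDiffOn_Ici 0 s hs)
    exact contDiffOn_const.div (ih.1.pow 2) fun s hs => pow_ne_zero 2 (h0 s hs)

lemma contDiffOn_uProfile (hro : 0 < ro) (hm : m ≤ ro / 2) :
    ContDiffOn ℝ ∞ (uProfile m ro) (Ici 0) :=
  contDiffOn_infty.2 fun n => (contDiffOn_uProfile_uSpeed hro hm n).1

end Profile

/-! ### Calculus of coordinate derivatives -/

section PartialDerivatives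

open Filter Topology

variable {E H ι : Type*} [NormedAddCommGroup E] [NormedSpace ℝ E] [TopologicalSpace H]
  {I : ModelWithCorners ℝ E H} {b : Module.Basis ι ℝ E} {f g : E → ℝ} {y : E} {i j : ι}

/-- Smoothness at a point of the model, within the range of the model with corners. -/
abbrev SmoothIn (I : ModelWithCorners ℝ E H) (f : E → ℝ) (y : E) : Prop :=
  ContDiffWithinAt ℝ ∞ f (range I) y

lemma SmoothIn.differentiableWithinAt (hf : SmoothIn I f y) :
    DifferentiableWithinAt ℝ f (range I) y :=
  ContDiffWithinAt.differentiableWithinAt hf (by simp)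

lemma pd_congr (h : f =ᶠ[𝓝[range I] y] g) (hy : y ∈ range I) : pd I b i f y = pd I b i g y := by
  unfold pd
  rw [h.fderivWithin_eq (h.self_of_nhdsWithin hy)]

lemma pd_eventuallyEq (h : f =ᶠ[𝓝[range I] y] g) :
    pd I b i f =ᶠ[𝓝[range I] y] pd I b i g := by
  filter_upwards [eventually_eventually_nhdsWithin.2 h, self_mem_nhdsWithin] with z hz hz'
    using pd_congr hz hz'

lemma pd_const (c : ℝ) : pd I b i (fun _ => c) y = 0 := by
  simp [pd]

lemma pd_add (hy : y ∈ range I) (hf : DifferentiableWithinAt ℝ f (range I) y)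
    (hg : DifferentiableWithinAt ℝ g (range I) y) :
    pd I b i (fun z => f z + g z) y = pd I b i f y + pd I b i g y := by
  unfold pd
  rw [fderivWithin_fun_add (I.uniqueDiffOn y hy) hf hg]; rfl

lemma pd_sub (hy : y ∈ range I) (hf : DifferentiableWithinAt ℝ f (range I) y)
    (hg : DifferentiableWithinAt ℝ g (range I) y) :
    pd I b i (fun z => f z - g z) y = pd I b i f y - pd I b i g y := by
  unfold pd
  rw [fderivWithin_fun_sub (I.uniqueDiffOn y hy) hf hg]; rfl

lemma pd_mul (hy : y ∈ range I) (hf : DifferentiableWithinAt ℝ f (range I) y)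
    (hg : DifferentiableWithinAt ℝ g (range I) y) :
    pd I b i (fun z => f z * g z) y = pd I b i f y * g y + f y * pd I b i g y := by
  unfold pd
  rw [fderivWithin_fun_mul (I.uniqueDiffOn y hy) hf hg]
  simp only [add_apply, smul_apply, smul_eq_mul]
  ring

lemma pd_const_mul (hy : y ∈ range I) (c : ℝ) (hf : DifferentiableWithinAt ℝ f (range I) y) :
    pd I b i (fun z => c * f z) y = c * pd I b i f y := by
  rw [pd_mul hy (differentiableWithinAt_const c) hf, pd_const, zero_mul, zero_add]

lemma pd_sum {κ : Type*} {s : Finset κ} {F : κ → E → ℝ} (hy : y ∈ range I)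
    (hF : ∀ a ∈ s, DifferentiableWithinAt ℝ (F a) (range I) y) :
    pd I b i (fun z => ∑ a ∈ s, F a z) y = ∑ a ∈ s, pd I b i (F a) y := by
  unfold pd
  rw [fderivWithin_fun_sum (I.uniqueDiffOn y hy) hF]
  simp

lemma SmoothIn.pd (hf : SmoothIn I f y) (hy : y ∈ range I) : SmoothIn I (pd I b i f) y :=
  (ContDiffWithinAt.fderivWithin_right hf I.uniqueDiffOn (m := ∞) (by simp) hy).clm_apply
    contDiffWithinAt_const

/-- Second derivatives commute at boundary points too, because `range I` lies in the closure of its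
interior. -/
lemma pd_comm (hf : SmoothIn I f y) (hy : y ∈ range I) :
    Collar.pd I b i (Collar.pd I b j f) y = Collar.pd I b j (Collar.pd I b i f) y := by
  have hs : IsSymmSndFDerivWithinAt ℝ f (range I) y :=
    ContDiffWithinAt.isSymmSndFDerivWithinAt hf
      (by rw [minSmoothness_of_isRCLikeNormedField]; exact WithTop.coe_le_coe.2 (le_top : (2 : ℕ∞) ≤ ⊤)) I.uniqueDiffOn
      (I.range_subset_closure_interior hy) hy
  have hd : DifferentiableWithinAt ℝ (fderivWithin ℝ f (range I)) (range I) y :=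
    (ContDiffWithinAt.fderivWithin_right hf I.uniqueDiffOn (m := ∞) (by simp)
      hy).differentiableWithinAt (by simp)
  have key : ∀ v w : E, fderivWithin ℝ (fun z => fderivWithin ℝ f (range I) z v) (range I) y w
      = fderivWithin ℝ (fderivWithin ℝ f (range I)) (range I) y w v := fun v w => by
    rw [fderivWithin_clm_apply (I.uniqueDiffOn y hy) hd (differentiableWithinAt_const v)]
    simp
  have := hs (b i) (b j)
  rw [← key, ← key] at this
  exact this

end PartialDerivatives

/-! ### Curvature of coordinate metrics -/

section CoordinateCurvature

open Filter Topology

variable {E H ι : Type*} [NormedAddCommGroup E] [NormedSpace ℝ E] [TopologicalSpace H]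
  {I : ModelWithCorners ℝ E H} {y : E}

lemma christoffel_eventuallyEq [Fintype ι] [DecidableEq ι] {b : Module.Basis ι ℝ E}
    {G G' : E → Matrix ι ι ℝ} (h : G =ᶠ[𝓝[range I] y] G') (k i j : ι) :
    christoffel I b G k i j =ᶠ[𝓝[range I] y] christoffel I b G' k i j := by
  have h' : ∀ r s t : ι, pd I b r (fun z => G z s t) =ᶠ[𝓝[range I] y]
      pd I b r (fun z => G' z s t) := fun r s t =>
    pd_eventuallyEq (h.mono fun z hz => by simp only [hz])
  have h2 : ∀ᶠ z in 𝓝[range I] y, ∀ r s t : ι, pd I b r (fun z => G z s t) z =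
      pd I b r (fun z => G' z s t) z := by
    simp only [eventually_all]; exact h'
  filter_upwards [h, h2] with z hz hz'
  simp only [christoffel, hz, hz']

/-- Curvature depends only on the germ of G at y, so the coordinate metric may be replaced by the
block form that it has on the chart target. -/
lemma riemann_congr [Fintype ι] [DecidableEq ι] {b : Module.Basis ι ℝ E}
    {G G' : E → Matrix ι ι ℝ} (h : G =ᶠ[𝓝[range I] y] G') (hy : y ∈ range I) (i j k l : ι) :
    riemann I b G i j k l y = riemann I b G' i j k l y := by
  have h1 : ∀ r s t, christoffel I b G r s t y = christoffel I b G' r s t y := fun r s t =>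
    (christoffel_eventuallyEq h r s t).self_of_nhdsWithin hy
  simp only [riemann, h1, pd_congr (christoffel_eventuallyEq h _ _ _) hy]

/-- The entries of the inverse of a smooth field of invertible `2 × 2` matrices are smooth. -/
lemma SmoothIn.inv_entry {P : E → Matrix (Fin 2) (Fin 2) ℝ}
    (hP : ∀ a c, SmoothIn I (fun z => P z a c) y) (hdet : (P y).det ≠ 0) (a c : Fin 2) :
    SmoothIn I (fun z => (P z)⁻¹ a c) y := by
  have hd : SmoothIn I (fun z => (P z).det) y := by
    simp only [Matrix.det_fin_two]
    exact ((hP 0 0).mul (hP 1 1)).sub ((hP 0 1).mul (hP 1 0))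
  have hadj : SmoothIn I (fun z => (P z).adjugate a c) y := by
    simp only [Matrix.adjugate_fin_two]
    fin_cases a <;> fin_cases c
    · exact hP 1 1
    · exact (hP 0 1).neg
    · exact (hP 1 0).neg
    · exact hP 0 0
  simp only [Matrix.inv_def, Matrix.smul_apply, smul_eq_mul, Ring.inverse_eq_inv']
  exact (hd.inv hdet).mul hadj

lemma SmoothIn.eventually_det_ne_zero {P : E → Matrix (Fin 2) (Fin 2) ℝ}
    (hP : ∀ a c, SmoothIn I (fun z => P z a c) y) (hdet : (P y).det ≠ 0) :
    ∀ᶠ z in 𝓝[range I] y, (P z).det ≠ 0 := by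
  have hd : ContinuousWithinAt (fun z => (P z).det) (range I) y := by
    simp only [Matrix.det_fin_two]
    exact (((hP 0 0).mul (hP 1 1)).sub ((hP 0 1).mul (hP 1 0))).continuousWithinAt
  exact hd.eventually_ne hdet

lemma smoothIn_christoffel {b : Module.Basis (Fin 2) ℝ E} {G : E → Matrix (Fin 2) (Fin 2) ℝ}
    (hG : ∀ a c, SmoothIn I (fun z => G z a c) y) (hdet : (G y).det ≠ 0) (hy : y ∈ range I)
    (k i j : Fin 2) : SmoothIn I (christoffel I b G k i j) y := by
  unfold christoffel
  refine contDiffWithinAt_const.mul (ContDiffWithinAt.sum fun l _ => ?_)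
  exact (SmoothIn.inv_entry hG hdet k l).mul
    ((((hG _ _).pd hy).add ((hG _ _).pd hy)).sub ((hG _ _).pd hy))

/-- In dimension two the curvature tensor `R_{01kl}` is skew in its last two indices. -/
lemma riemann_skew {b : Module.Basis (Fin 2) ℝ E} {G : E → Matrix (Fin 2) (Fin 2) ℝ}
    (hG : ∀ a c, SmoothIn I (fun z => G z a c) y) (hdet : (G y).det ≠ 0) (hy : y ∈ range I)
    (hsymm : ∀ z a c, G z a c = G z c a) :
    ∑ l, G y l 1 * riemann I b G 0 1 0 l y + ∑ l, G y l 0 * riemann I b G 0 1 1 l y = 0 := by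
  -- Lowering the upper index removes the inverse matrix, so that differentiating the identity
  -- yields second derivatives of G only.
  have lower : ∀ l i k, (fun z => ∑ n, G z l n * christoffel I b G n i k z)
      =ᶠ[𝓝[range I] y] fun z => (1 / 2) * (pd I b i (fun z => G z k l) z
        + pd I b k (fun z => G z i l) z - pd I b l (fun z => G z i k) z) := fun l i k => by
    filter_upwards [SmoothIn.eventually_det_ne_zero hG hdet] with z hz
    have h1 : G z * (G z)⁻¹ = 1 := Matrix.mul_nonsing_inv _ (Ne.isUnit hz)
    have h2 : ∀ r, ∑ n, G z l n * (G z)⁻¹ n r = (1 : Matrix (Fin 2) (Fin 2) ℝ) l r := fun r => by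
      rw [← h1, Matrix.mul_apply]
    have h3 := h2 0
    have h4 := h2 1
    simp only [christoffel, Fin.sum_univ_two] at h3 h4 ⊢
    obtain rfl | rfl : l = 0 ∨ l = 1 := by fin_cases l <;> simp
    all_goals
      simp only [Matrix.one_apply_eq, ne_eq, one_ne_zero, zero_ne_one, not_false_eq_true,
        Matrix.one_apply_ne] at h3 h4
      linear_combination (1 / 2) * (pd I b i (fun z => G z k 0) z
        + pd I b k (fun z => G z i 0) z - pd I b 0 (fun z => G z i k) z) * h3
        + (1 / 2) * (pd I b i (fun z => G z k 1) z
        + pd I b k (fun z => G z i 1) z - pd I b 1 (fun z => G z i k) z) * h4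
  have hΓ := fun k i j => (smoothIn_christoffel (b := b) hG hdet hy k i j).differentiableWithinAt
  have hGd := fun k l => (hG k l).differentiableWithinAt
  have hpG : ∀ i k l, DifferentiableWithinAt ℝ (pd I b i fun z => G z k l) (range I) y :=
    fun i k l => ((hG k l).pd hy).differentiableWithinAt
  have low0 : ∀ l i k, G y l 0 * christoffel I b G 0 i k y + G y l 1 * christoffel I b G 1 i k y
      = (1 / 2) * (pd I b i (fun z => G z k l) y
        + pd I b k (fun z => G z i l) y - pd I b l (fun z => G z i k) y) := fun l i k => by
    simpa [Fin.sum_univ_two] using (lower l i k).self_of_nhdsWithin hy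
  have dlow : ∀ j l i k,
      pd I b j (fun z => G z l 0) y * christoffel I b G 0 i k y
        + G y l 0 * pd I b j (christoffel I b G 0 i k) y
        + (pd I b j (fun z => G z l 1) y * christoffel I b G 1 i k y
        + G y l 1 * pd I b j (christoffel I b G 1 i k) y)
      = (1 / 2) * (pd I b j (pd I b i (fun z => G z k l)) y
        + pd I b j (pd I b k (fun z => G z i l)) y
        - pd I b j (pd I b l (fun z => G z i k)) y) := fun j l i k => by
    have := pd_congr (b := b) (i := j) (lower l i k) hy
    simp only [Fin.sum_univ_two] at this
    rw [pd_add hy ((hGd _ _).fun_mul (hΓ _ _ _)) ((hGd _ _).fun_mul (hΓ _ _ _)),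
      pd_mul hy (hGd _ _) (hΓ _ _ _), pd_mul hy (hGd _ _) (hΓ _ _ _),
      pd_const_mul hy _ (((hpG _ _ _).fun_add (hpG _ _ _)).fun_sub (hpG _ _ _)),
      pd_sub hy ((hpG _ _ _).fun_add (hpG _ _ _)) (hpG _ _ _),
      pd_add hy (hpG _ _ _) (hpG _ _ _)] at this
    exact this
  have hc := fun k l => pd_comm (b := b) (i := 0) (j := 1) (hG k l) hy
  have s10 : ∀ i, pd I b i (fun z => G z 1 0) = pd I b i (fun z => G z 0 1) := fun i => by
    simp only [hsymm _ 1 0]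
  have g10 := hsymm y 1 0
  have hΓs : ∀ n, christoffel I b G n 1 0 = christoffel I b G n 0 1 := fun n => by
    funext z
    simp only [christoffel, hsymm _ 1 0, Fin.sum_univ_two]
    ring
  have c01 := hc 0 1
  have d1 := dlow 0 1 1 0
  have d2 := dlow 1 1 0 0
  have d3 := dlow 0 0 1 1
  have d4 := dlow 1 0 0 1
  have l00 := low0 0 0 0
  have l01 := low0 0 0 1
  have l11 := low0 0 1 1
  have m00 := low0 1 0 0
  have m01 := low0 1 0 1
  have m11 := low0 1 1 1
  simp only [riemann, Fin.sum_univ_two, g10, s10, hΓs] at *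
  set a0 := christoffel I b G 0 0 0 y
  set a1 := christoffel I b G 1 0 0 y
  set b0 := christoffel I b G 0 0 1 y
  set b1 := christoffel I b G 1 0 1 y
  set e0 := christoffel I b G 0 1 1 y
  set e1 := christoffel I b G 1 1 1 y
  -- The differentiated identities `d1` to `d4` turn derivatives of Γ into second derivatives of G,
  -- which cancel by symmetry and `c01`; the undifferentiated ones absorb the products of ∂G with Γ.
  linear_combination d1 - d2 + d3 - d4 + m00 * b0 + m01 * b1 - m01 * a0 - m11 * a1 + l00 * e0
    + l01 * e1 - l01 * b0 - l11 * b1 - l11 * a0 - m11 * a1 + l00 * e0 + m00 * e1 + c01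

/-- In dimension two the scalar curvature is twice the Gauss curvature. -/
lemma sum_riemann_eq_two_mul {b : Module.Basis (Fin 2) ℝ E} {G : E → Matrix (Fin 2) (Fin 2) ℝ}
    (hG : ∀ a c, SmoothIn I (fun z => G z a c) y) (hdet : (G y).det ≠ 0) (hy : y ∈ range I)
    (hsymm : ∀ z a c, G z a c = G z c a) :
    ∑ j, ∑ k, (G y)⁻¹ j k * ∑ i, riemann I b G i j k i y
      = 2 * ((∑ l, G y l 0 * riemann I b G 0 1 1 l y) / (G y 0 0 * G y 1 1 - G y 0 1 ^ 2)) := by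
  have h := riemann_skew (b := b) hG hdet hy hsymm
  have hz : ∀ i k l, riemann I b G i i k l y = 0 := fun i k l => by simp [riemann]
  have ha : ∀ k l, riemann I b G 1 0 k l y = -riemann I b G 0 1 k l y := fun k l => by
    simp only [riemann, Fin.sum_univ_two]; ring
  have hs := hsymm y 1 0
  rw [Matrix.det_fin_two, hs] at hdet
  have hd : G y 0 0 * G y 1 1 - G y 0 1 ^ 2 ≠ 0 := by rwa [pow_two]
  simp only [Matrix.inv_def, Matrix.adjugate_fin_two, Matrix.det_fin_two, Fin.sum_univ_two,
    Matrix.smul_apply, smul_eq_mul, hz, ha, hs, Ring.inverse_eq_inv', Matrix.of_apply,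
    Matrix.cons_val_zero, Matrix.cons_val_one, ← pow_two] at h ⊢
  field_simp
  linear_combination -h

end CoordinateCurvature

/-! ### Metrics of the form `A² dt² + P` -/

section BlockMetric

open Filter Topology

variable {E H : Type*} [NormedAddCommGroup E] [NormedSpace ℝ E] [TopologicalSpace H]
  {I : ModelWithCorners ℝ E H} {b : Module.Basis (Fin 1 ⊕ Fin 2) ℝ E} {A : ℝ}
  {P : E → Matrix (Fin 2) (Fin 2) ℝ} {y : E}

/-- The coordinate metric `A² dt² + P`. -/
def blockMetric (A : ℝ) (P : E → Matrix (Fin 2) (Fin 2) ℝ) (z : E) :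
    Matrix (Fin 1 ⊕ Fin 2) (Fin 1 ⊕ Fin 2) ℝ :=
  Matrix.fromBlocks (Matrix.of fun _ _ => A ^ 2) 0 0 (P z)

lemma blockMetric_inv (hA : A ≠ 0) {z : E} (hz : (P z).det ≠ 0) :
    (blockMetric A P z)⁻¹ = Matrix.fromBlocks (Matrix.of fun _ _ => (A ^ 2)⁻¹) 0 0 (P z)⁻¹ := by
  apply Matrix.inv_eq_right_inv
  rw [blockMetric, Matrix.fromBlocks_multiply]
  simp only [Matrix.mul_zero, Matrix.zero_mul, add_zero, zero_add,
    Matrix.mul_nonsing_inv _ (Ne.isUnit hz)]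
  rw [← Matrix.fromBlocks_one]
  congr
  ext i j
  rw [Subsingleton.elim j i]
  simp [Matrix.mul_apply, hA]

/-- The Christoffel symbols of the slices of a block metric. -/
def sliceChristoffel (I : ModelWithCorners ℝ E H) (b : Module.Basis (Fin 1 ⊕ Fin 2) ℝ E)
    (P : E → Matrix (Fin 2) (Fin 2) ℝ) (k i j : Fin 2) (z : E) : ℝ :=
  (1 / 2) * ∑ l, (P z)⁻¹ k l * (pd I b (Sum.inr i) (fun z => P z j l) z
    + pd I b (Sum.inr j) (fun z => P z i l) z - pd I b (Sum.inr l) (fun z => P z i j) z)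

/-- The curvature components of the slices of a block metric. -/
def sliceRiemann (I : ModelWithCorners ℝ E H) (b : Module.Basis (Fin 1 ⊕ Fin 2) ℝ E)
    (P : E → Matrix (Fin 2) (Fin 2) ℝ) (i j k l : Fin 2) (z : E) : ℝ :=
  pd I b (Sum.inr i) (sliceChristoffel I b P l j k) z
    - pd I b (Sum.inr j) (sliceChristoffel I b P l i k) z
    + ∑ n, (sliceChristoffel I b P l i n z * sliceChristoffel I b P n j k z
      - sliceChristoffel I b P l j n z * sliceChristoffel I b P n i k z)

/-- The derivative of the slice metrics in the transversal direction. -/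
def transDeriv (I : ModelWithCorners ℝ E H) (b : Module.Basis (Fin 1 ⊕ Fin 2) ℝ E)
    (P : E → Matrix (Fin 2) (Fin 2) ℝ) (z : E) : Matrix (Fin 2) (Fin 2) ℝ :=
  Matrix.of fun a c => pd I b (Sum.inl 0) (fun z => P z a c) z

/-- The mixed form `½ P⁻¹ P'`. -/
def shape (I : ModelWithCorners ℝ E H) (b : Module.Basis (Fin 1 ⊕ Fin 2) ℝ E)
    (P : E → Matrix (Fin 2) (Fin 2) ℝ) (a c : Fin 2) (z : E) : ℝ :=
  (1 / 2) * ∑ d, (P z)⁻¹ a d * transDeriv I b P z d c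

/-! ### Christoffel symbols of A² dt² + P -/

section Christoffel

variable (hA : A ≠ 0) {z : E} (hz : (P z).det ≠ 0) (hsymm : ∀ z a c, P z a c = P z c a)
include hA hz

lemma christoffel_block_ttt : christoffel I b (blockMetric A P) (Sum.inl 0) (Sum.inl 0)
    (Sum.inl 0) z = 0 := by
  simp only [christoffel, blockMetric_inv hA hz]
  simp [blockMetric, pd_const]

lemma christoffel_block_tta (a : Fin 2) : christoffel I b (blockMetric A P) (Sum.inl 0)
    (Sum.inl 0) (Sum.inr a) z = 0 := by
  simp only [christoffel, blockMetric_inv hA hz]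
  simp [blockMetric, pd_const]

lemma christoffel_block_tat (a : Fin 2) : christoffel I b (blockMetric A P) (Sum.inl 0)
    (Sum.inr a) (Sum.inl 0) z = 0 := by
  simp only [christoffel, blockMetric_inv hA hz]
  simp [blockMetric, pd_const]

lemma christoffel_block_tab (a c : Fin 2) : christoffel I b (blockMetric A P) (Sum.inl 0)
    (Sum.inr a) (Sum.inr c) z = -(1 / 2) * (A ^ 2)⁻¹ * transDeriv I b P z a c := by
  simp only [christoffel, blockMetric_inv hA hz]
  simp [blockMetric, pd_const, transDeriv]
  ring

lemma christoffel_block_att (a : Fin 2) : christoffel I b (blockMetric A P) (Sum.inr a)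
    (Sum.inl 0) (Sum.inl 0) z = 0 := by
  simp only [christoffel, blockMetric_inv hA hz]
  simp [blockMetric, pd_const]

include hsymm in
lemma christoffel_block_atb (a c : Fin 2) : christoffel I b (blockMetric A P) (Sum.inr a)
    (Sum.inl 0) (Sum.inr c) z = shape I b P a c z := by
  simp only [christoffel, blockMetric_inv hA hz]
  simp [blockMetric, pd_const, transDeriv, shape, hsymm _ c 0, hsymm _ c 1]

include hsymm in
lemma christoffel_block_abt (a c : Fin 2) : christoffel I b (blockMetric A P) (Sum.inr a)
    (Sum.inr c) (Sum.inl 0) z = shape I b P a c z := by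
  simp only [christoffel, blockMetric_inv hA hz]
  simp [blockMetric, pd_const, transDeriv, shape, hsymm _ c 0, hsymm _ c 1]

lemma christoffel_block_abc (a c d : Fin 2) : christoffel I b (blockMetric A P) (Sum.inr a)
    (Sum.inr c) (Sum.inr d) z = sliceChristoffel I b P a c d z := by
  simp only [christoffel, blockMetric_inv hA hz]
  simp [blockMetric, sliceChristoffel]

end Christoffel

variable (hA : A ≠ 0) (hP : ∀ a c, SmoothIn I (fun z => P z a c) y) (hdet : (P y).det ≠ 0)
  (hy : y ∈ range I) (hsymm : ∀ z a c, P z a c = P z c a)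

include hP hdet hy in
lemma smoothIn_shape (a c : Fin 2) : SmoothIn I (shape I b P a c) y := by
  unfold shape
  refine contDiffWithinAt_const.mul (ContDiffWithinAt.sum fun d _ => ?_)
  exact (SmoothIn.inv_entry hP hdet a d).mul ((hP d c).pd hy)

/-- The trace `P^{ac} P'_{ac}`. -/
def transTrace (I : ModelWithCorners ℝ E H) (b : Module.Basis (Fin 1 ⊕ Fin 2) ℝ E)
    (P : E → Matrix (Fin 2) (Fin 2) ℝ) (z : E) : ℝ :=
  ∑ a, ∑ c, (P z)⁻¹ a c * transDeriv I b P z a c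

/-- The squared norm `|P'|²_P`. -/
def transNormSq (I : ModelWithCorners ℝ E H) (b : Module.Basis (Fin 1 ⊕ Fin 2) ℝ E)
    (P : E → Matrix (Fin 2) (Fin 2) ℝ) (z : E) : ℝ :=
  ∑ i, ∑ j, ∑ k, ∑ l,
    (P z)⁻¹ i k * (P z)⁻¹ j l * transDeriv I b P z i j * transDeriv I b P z k l

include hsymm in
lemma transDeriv_symm (z : E) (a c : Fin 2) :
    transDeriv I b P z a c = transDeriv I b P z c a := by
  simp only [transDeriv, Matrix.of_apply, hsymm _ a c]

include hsymm in
lemma inv_symm (z : E) (a c : Fin 2) : (P z)⁻¹ a c = (P z)⁻¹ c a := by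
  have : (P z).transpose = P z := by ext i j; exact hsymm z j i
  conv_rhs => rw [← this, ← Matrix.transpose_nonsing_inv]
  rfl

include hsymm in
lemma sum_shape (z : E) : shape I b P 0 0 z + shape I b P 1 1 z = (1 / 2) * transTrace I b P z := by
  simp only [shape, transTrace, Fin.sum_univ_two, transDeriv_symm (I := I) (b := b) hsymm z 1 0]
  ring

include hP hdet hy in
/-- The derivative of the inverse matrix. -/
lemma transDeriv_inv (a c : Fin 2) :
    pd I b (Sum.inl 0) (fun z => (P z)⁻¹ a c) y
      = -((P y)⁻¹ * transDeriv I b P y * (P y)⁻¹) a c := by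
  have hQ := SmoothIn.inv_entry hP hdet
  set D : Matrix (Fin 2) (Fin 2) ℝ :=
    Matrix.of fun a c => pd I b (Sum.inl 0) (fun z => (P z)⁻¹ a c) y
  -- Differentiate P⁻¹ P = 1, which holds near y because the determinant stays nonzero.
  have key : D * P y + (P y)⁻¹ * transDeriv I b P y = 0 := by
    ext a c
    have h1 : (fun z => ∑ n, (P z)⁻¹ a n * P z n c) =ᶠ[𝓝[range I] y]
        fun _ => (1 : Matrix (Fin 2) (Fin 2) ℝ) a c := by
      filter_upwards [SmoothIn.eventually_det_ne_zero hP hdet] with z hz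
      rw [← Matrix.nonsing_inv_mul (P z) (Ne.isUnit hz), Matrix.mul_apply]
    have h2 := pd_congr (b := b) (i := Sum.inl 0) h1 hy
    rw [pd_const, pd_sum hy fun n _ =>
      (hQ a n).differentiableWithinAt.fun_mul (hP n c).differentiableWithinAt] at h2
    simp only [pd_mul hy (hQ _ _).differentiableWithinAt (hP _ _).differentiableWithinAt,
      Finset.sum_add_distrib] at h2
    exact h2
  have h3 : D = -((P y)⁻¹ * transDeriv I b P y * (P y)⁻¹) := by
    rw [← Matrix.neg_mul, ← eq_neg_of_add_eq_zero_left key, Matrix.mul_assoc,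
      Matrix.mul_nonsing_inv _ (Ne.isUnit hdet), Matrix.mul_one]
  exact congrFun (congrFun h3 a) c

include hP hdet hy hsymm in
-- Product rule for tr_P P': the term where the derivative falls on P⁻¹ is -|P'|². It trades the
-- second derivative of P for the derivative of the trace.
lemma sum_inv_mul_pd_transDeriv :
    ∑ a, ∑ c, (P y)⁻¹ a c * pd I b (Sum.inl 0) (fun z => transDeriv I b P z a c) y
      = pd I b (Sum.inl 0) (transTrace I b P) y + transNormSq I b P y := by
  have hQ := fun a c => (SmoothIn.inv_entry hP hdet a c).differentiableWithinAt
  have hK : ∀ a c, DifferentiableWithinAt ℝ (fun z => transDeriv I b P z a c) (range I) y :=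
    fun a c => ((hP a c).pd hy).differentiableWithinAt
  have h : pd I b (Sum.inl 0) (transTrace I b P) y = ∑ a, ∑ c,
      (pd I b (Sum.inl 0) (fun z => (P z)⁻¹ a c) y * transDeriv I b P y a c
        + (P y)⁻¹ a c * pd I b (Sum.inl 0) (fun z => transDeriv I b P z a c) y) := by
    unfold transTrace
    rw [pd_sum hy fun a _ => DifferentiableWithinAt.fun_sum fun c _ => (hQ a c).fun_mul (hK a c)]
    simp only [pd_sum hy fun c _ => (hQ _ c).fun_mul (hK _ c), pd_mul hy (hQ _ _) (hK _ _)]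
  rw [h]
  simp only [transDeriv_inv hP hdet hy, Matrix.mul_apply, transNormSq, Fin.sum_univ_two,
    transDeriv_symm (I := I) (b := b) hsymm y 1 0, inv_symm hsymm y 1 0]
  ring

include hA hP hdet hy hsymm in
/-- The scalar curvature of `A² dt² + P`. -/
lemma sum_riemann_block :
    ∑ j, ∑ k, (blockMetric A P y)⁻¹ j k * ∑ i, riemann I b (blockMetric A P) i j k i y
      = ∑ j, ∑ k, (P y)⁻¹ j k * ∑ i, sliceRiemann I b P i j k i y
        - (A ^ 2)⁻¹ * (pd I b (Sum.inl 0) (transTrace I b P) y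
          + (1 / 4) * transNormSq I b P y + (1 / 4) * transTrace I b P y ^ 2) := by
  have hev := SmoothIn.eventually_det_ne_zero hP hdet
  have e_ttt : christoffel I b (blockMetric A P) (Sum.inl 0) (Sum.inl 0) (Sum.inl 0)
      =ᶠ[𝓝[range I] y] fun _ => 0 := hev.mono fun z hz => christoffel_block_ttt hA hz
  have e_tta : ∀ a, christoffel I b (blockMetric A P) (Sum.inl 0) (Sum.inl 0) (Sum.inr a)
      =ᶠ[𝓝[range I] y] fun _ => 0 := fun a => hev.mono fun z hz => christoffel_block_tta hA hz a
  have e_tat : ∀ a, christoffel I b (blockMetric A P) (Sum.inl 0) (Sum.inr a) (Sum.inl 0)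
      =ᶠ[𝓝[range I] y] fun _ => 0 := fun a => hev.mono fun z hz => christoffel_block_tat hA hz a
  have e_tab : ∀ a c, christoffel I b (blockMetric A P) (Sum.inl 0) (Sum.inr a) (Sum.inr c)
      =ᶠ[𝓝[range I] y] fun z => -(1 / 2) * (A ^ 2)⁻¹ * transDeriv I b P z a c :=
    fun a c => hev.mono fun z hz => christoffel_block_tab hA hz a c
  have e_att : ∀ a, christoffel I b (blockMetric A P) (Sum.inr a) (Sum.inl 0) (Sum.inl 0)
      =ᶠ[𝓝[range I] y] fun _ => 0 := fun a => hev.mono fun z hz => christoffel_block_att hA hz a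
  have e_atb : ∀ a c, christoffel I b (blockMetric A P) (Sum.inr a) (Sum.inl 0) (Sum.inr c)
      =ᶠ[𝓝[range I] y] shape I b P a c :=
    fun a c => hev.mono fun z hz => christoffel_block_atb hA hz hsymm a c
  have e_abt : ∀ a c, christoffel I b (blockMetric A P) (Sum.inr a) (Sum.inr c) (Sum.inl 0)
      =ᶠ[𝓝[range I] y] shape I b P a c :=
    fun a c => hev.mono fun z hz => christoffel_block_abt hA hz hsymm a c
  have e_abc : ∀ a c d, christoffel I b (blockMetric A P) (Sum.inr a) (Sum.inr c) (Sum.inr d)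
      =ᶠ[𝓝[range I] y] sliceChristoffel I b P a c d :=
    fun a c d => hev.mono fun z hz => christoffel_block_abc hA hz a c d
  have hK : ∀ a c, DifferentiableWithinAt ℝ (fun z => transDeriv I b P z a c) (range I) y :=
    fun a c => ((hP a c).pd hy).differentiableWithinAt
  have hS := fun a c => (smoothIn_shape (b := b) hP hdet hy a c).differentiableWithinAt
  have r_tttt : riemann I b (blockMetric A P) (Sum.inl 0) (Sum.inl 0) (Sum.inl 0) (Sum.inl 0) y
      = 0 := by simp [riemann]
  have r_atta : ∀ a, riemann I b (blockMetric A P) (Sum.inr a) (Sum.inl 0) (Sum.inl 0) (Sum.inr a) y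
      = -pd I b (Sum.inl 0) (shape I b P a a) y
        - ∑ c, shape I b P a c y * shape I b P c a y := fun a => by
    simp only [riemann, Fintype.sum_sum_type, Fin.sum_univ_two, Finset.univ_unique,
      Fin.default_eq_zero, Finset.sum_singleton, pd_congr (e_att _) hy, pd_congr (e_abt _ _) hy,
      pd_const, (e_att _).self_of_nhdsWithin hy, (e_abt _ _).self_of_nhdsWithin hy,
      (e_atb _ _).self_of_nhdsWithin hy, (e_abc _ _ _).self_of_nhdsWithin hy,
      (e_ttt).self_of_nhdsWithin hy, (e_tat _).self_of_nhdsWithin hy]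
    ring
  have r_tbct : ∀ a c, riemann I b (blockMetric A P) (Sum.inl 0) (Sum.inr a) (Sum.inr c)
      (Sum.inl 0) y = -(1 / 2) * (A ^ 2)⁻¹ * pd I b (Sum.inl 0) (fun z => transDeriv I b P z a c) y
        + (1 / 2) * (A ^ 2)⁻¹ * ∑ d, transDeriv I b P y a d * shape I b P d c y := fun a c => by
    simp only [riemann, Fintype.sum_sum_type, Fin.sum_univ_two, Finset.univ_unique,
      Fin.default_eq_zero, Finset.sum_singleton, pd_congr (e_tab _ _) hy, pd_congr (e_tta _) hy,
      pd_const, pd_const_mul hy _ (hK _ _), (e_tab _ _).self_of_nhdsWithin hy,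
      (e_atb _ _).self_of_nhdsWithin hy, (e_tta _).self_of_nhdsWithin hy,
      (e_ttt).self_of_nhdsWithin hy, (e_tat _).self_of_nhdsWithin hy]
    ring
  have r_abcd : ∀ a c d l, riemann I b (blockMetric A P) (Sum.inr a) (Sum.inr c) (Sum.inr d)
      (Sum.inr l) y = sliceRiemann I b P a c d l y
        - (1 / 2) * (A ^ 2)⁻¹ * (shape I b P l a y * transDeriv I b P y c d
          - shape I b P l c y * transDeriv I b P y a d) := fun a c d l => by
    simp only [riemann, Fintype.sum_sum_type, Fin.sum_univ_two, Finset.univ_unique,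
      Fin.default_eq_zero, Finset.sum_singleton, pd_congr (e_abc _ _ _) hy,
      (e_abc _ _ _).self_of_nhdsWithin hy, (e_tab _ _).self_of_nhdsWithin hy,
      (e_abt _ _).self_of_nhdsWithin hy, sliceRiemann]
    ring
  have hW : pd I b (Sum.inl 0) (shape I b P 0 0) y + pd I b (Sum.inl 0) (shape I b P 1 1) y
      = (1 / 2) * pd I b (Sum.inl 0) (transTrace I b P) y := by
    have hT : DifferentiableWithinAt ℝ (transTrace I b P) (range I) y :=
      DifferentiableWithinAt.fun_sum fun a _ => DifferentiableWithinAt.fun_sum fun c _ =>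
        (SmoothIn.inv_entry hP hdet a c).differentiableWithinAt.fun_mul (hK a c)
    rw [← pd_const_mul hy _ hT, ← pd_add hy (hS _ _) (hS _ _)]
    simp only [sum_shape hsymm]
  have hN := sum_inv_mul_pd_transDeriv (b := b) hP hdet hy hsymm
  rw [blockMetric_inv hA hdet]
  simp only [Fintype.sum_sum_type, Fin.sum_univ_two, Finset.univ_unique, Fin.default_eq_zero,
    Finset.sum_singleton, Matrix.fromBlocks_apply₁₁, Matrix.fromBlocks_apply₁₂,
    Matrix.fromBlocks_apply₂₁, Matrix.fromBlocks_apply₂₂, Matrix.zero_apply, zero_mul, add_zero,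
    zero_add, Matrix.of_apply, r_tttt, r_atta, r_tbct, r_abcd] at hN ⊢
  have k10 := transDeriv_symm (I := I) (b := b) hsymm y 1 0
  have q10 := inv_symm hsymm y 1 0
  simp only [shape, transTrace, transNormSq, Fin.sum_univ_two, k10, q10] at hN hW ⊢
  -- The transversal derivative enters twice: through the tt-component as the derivative of the
  -- trace of `shape` (`hW`), and through the P⁻¹-contraction of the mixed components as P'' (`hN`).
  -- Each contributes half of the derivative of the trace.
  linear_combination (-(A ^ 2)⁻¹) * hW - (1 / 2) * (A ^ 2)⁻¹ * hN

end BlockMetric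

/-! ### Charts of the cylinder -/

section Charts

open Filter Topology

/-- The orientation of the preferred chart of `[0,1]` at `t₀`. -/
def chartSign (t₀ : Icc (0 : ℝ) 1) : ℝ := if (t₀ : ℝ) < 1 then 1 else -1

/-- The function `t` in the preferred chart of `[0,1]` at `t₀`. -/
def chartTime (t₀ : Icc (0 : ℝ) 1) (z : E₁) : ℝ := if (t₀ : ℝ) < 1 then z 0 else 1 - z 0

lemma chartSign_sq (t₀ : Icc (0 : ℝ) 1) : chartSign t₀ * chartSign t₀ = 1 := by
  unfold chartSign; split_ifs <;> norm_num

lemma chartTime_hasFDerivAt (t₀ : Icc (0 : ℝ) 1) (z : E₁) :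
    HasFDerivAt (chartTime t₀) (chartSign t₀ • (EuclideanSpace.proj 0 : E₁ →L[ℝ] ℝ)) z := by
  unfold chartTime chartSign
  split_ifs
  · rw [one_smul]; exact (EuclideanSpace.proj 0 : E₁ →L[ℝ] ℝ).hasFDerivAt
  · simpa using (EuclideanSpace.proj 0 : E₁ →L[ℝ] ℝ).hasFDerivAt.const_sub 1

lemma chartTime_contDiff (t₀ : Icc (0 : ℝ) 1) : ContDiff ℝ ∞ (chartTime t₀) := by
  unfold chartTime
  split_ifs
  · exact (EuclideanSpace.proj 0 : E₁ →L[ℝ] ℝ).contDiff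
  · exact contDiff_const.sub (EuclideanSpace.proj 0 : E₁ →L[ℝ] ℝ).contDiff

lemma coe_extChartAt_Icc_symm (t₀ : Icc (0 : ℝ) 1) {z : E₁}
    (hz : z ∈ (extChartAt (𝓡∂ 1) t₀).target) :
    (((extChartAt (𝓡∂ 1) t₀).symm z : Icc (0 : ℝ) 1) : ℝ) = chartTime t₀ z := by
  rw [extChartAt_target, range_modelWithCornersEuclideanHalfSpace] at hz
  obtain ⟨h1, h2⟩ := hz
  have h2' : 0 ≤ z 0 := h2
  by_cases h : (t₀ : ℝ) < 1
  · have h3 : (chartAt (EuclideanHalfSpace 1) t₀) = IccLeftChart 0 1 := by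
      simp [h]
    -- Membership in the target gives z 0 < 1, so the truncation to [0,1] in the inverse chart is
    -- inactive.
    have h4 : max (z 0) 0 < 1 - 0 := by
      rw [h3] at h1
      simpa [modelWithCornersEuclideanHalfSpace_symm_apply] using
        (show ((𝓡∂ 1).symm z).val 0 < 1 - 0 from h1)
    rw [max_eq_left h2'] at h4
    rw [extChartAt_coe_symm, h3]
    simp [IccLeftChart_symm_apply, modelWithCornersEuclideanHalfSpace_symm_apply, chartTime, h,
      max_eq_left h2']
    linarith
  · have h3 : (chartAt (EuclideanHalfSpace 1) t₀) = IccRightChart 0 1 := by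
      simp [h]
    have h4 : max (z 0) 0 < 1 - 0 := by
      rw [h3] at h1
      simpa [modelWithCornersEuclideanHalfSpace_symm_apply] using
        (show ((𝓡∂ 1).symm z).val 0 < 1 - 0 from h1)
    rw [max_eq_left h2'] at h4
    rw [extChartAt_coe_symm, h3]
    simp [IccRightChart_symm_apply, modelWithCornersEuclideanHalfSpace_symm_apply, chartTime, h,
      max_eq_left h2']
    linarith

lemma extChartAt_cylinder (p : N) :
    extChartAt modelN p = (extChartAt (𝓡∂ 1) p.1).prod (extChartAt (𝓡 2) p.2) :=
  extChartAt_prod p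

lemma mem_target_cylinder {p : N} {y : E₁ × E₂} (hy : y ∈ (extChartAt modelN p).target) :
    y.1 ∈ (extChartAt (𝓡∂ 1) p.1).target ∧ y.2 ∈ (extChartAt (𝓡 2) p.2).target := by
  rw [extChartAt_cylinder] at hy; exact hy

lemma coe_fst_symm {p : N} {y : E₁ × E₂} (hy : y ∈ (extChartAt modelN p).target) :
    timeFn ((extChartAt modelN p).symm y) = chartTime p.1 y.1 := by
  rw [← coe_extChartAt_Icc_symm p.1 (mem_target_cylinder hy).1, extChartAt_cylinder]; rfl

lemma snd_symm (p : N) (y : E₁ × E₂) :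
    ((extChartAt modelN p).symm y).2 = (extChartAt (𝓡 2) p.2).symm y.2 := by
  rw [extChartAt_cylinder]; rfl

lemma mdifferentiable_timeFn : MDifferentiable modelN 𝓘(ℝ, ℝ) timeFn := by
  have h : ContMDiff modelN 𝓘(ℝ, ℝ) ∞ timeFn :=
    (contMDiff_subtypeVal_Icc (x := 0) (y := 1)).comp contMDiff_fst
  exact h.mdifferentiable (by simp)

/-- Chain rule: read in the chart, t is affine in the first coordinate with slope `chartSign`. -/
lemma mfderiv_timeFn_symm {p : N} {y : E₁ × E₂} (hy : y ∈ (extChartAt modelN p).target)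
    (v : E₁ × E₂) :
    mfderiv modelN 𝓘(ℝ, ℝ) timeFn ((extChartAt modelN p).symm y)
      (mfderivWithin 𝓘(ℝ, E₁ × E₂) modelN (extChartAt modelN p).symm (range modelN) y v)
      = chartSign p.1 * v.1 0 := by
  have hr : y ∈ range modelN := extChartAt_target_subset_range p hy
  have h1 : mfderivWithin 𝓘(ℝ, E₁ × E₂) 𝓘(ℝ, ℝ) (timeFn ∘ (extChartAt modelN p).symm)
      (range modelN) y = (mfderiv modelN 𝓘(ℝ, ℝ) timeFn ((extChartAt modelN p).symm y)).comp
      (mfderivWithin 𝓘(ℝ, E₁ × E₂) modelN (extChartAt modelN p).symm (range modelN) y) :=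
    mfderiv_comp_mfderivWithin y (mdifferentiable_timeFn _)
      (mdifferentiableWithinAt_extChartAt_symm hy)
      (modelN.uniqueDiffOn y hr).uniqueMDiffWithinAt
  have h2 : (timeFn ∘ (extChartAt modelN p).symm) =ᶠ[𝓝[range modelN] y]
      fun y => chartTime p.1 y.1 := by
    filter_upwards [extChartAt_target_mem_nhdsWithin_of_mem hy] with z hz using coe_fst_symm hz
  have h3 : HasFDerivWithinAt (fun y : E₁ × E₂ => chartTime p.1 y.1)
      ((chartSign p.1 • (EuclideanSpace.proj 0 : E₁ →L[ℝ] ℝ)).comp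
        (ContinuousLinearMap.fst ℝ E₁ E₂)) (range modelN) y :=
    ((chartTime_hasFDerivAt p.1 y.1).comp y hasFDerivAt_fst).hasFDerivWithinAt
  have h4 := DFunLike.congr_fun h1 v
  rw [mfderivWithin_eq_fderivWithin, h2.fderivWithin_eq (h2.self_of_nhdsWithin hr),
    h3.fderivWithin (modelN.uniqueDiffOn y hr)] at h4
  exact h4.symm

lemma mfderiv_snd_symm {p : N} {y : E₁ × E₂} (hy : y ∈ (extChartAt modelN p).target)
    (v : E₁ × E₂) :
    mfderiv modelN (𝓡 2) (Prod.snd : N → S2) ((extChartAt modelN p).symm y)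
      (mfderivWithin 𝓘(ℝ, E₁ × E₂) modelN (extChartAt modelN p).symm (range modelN) y v)
      = mfderivWithin 𝓘(ℝ, E₂) (𝓡 2) (extChartAt (𝓡 2) p.2).symm (range (𝓡 2)) y.2 v.2 := by
  have hr : y ∈ range modelN := extChartAt_target_subset_range p hy
  have hu := (modelN.uniqueDiffOn y hr).uniqueMDiffWithinAt
  have h1 : mfderivWithin 𝓘(ℝ, E₁ × E₂) (𝓡 2) (Prod.snd ∘ (extChartAt modelN p).symm)
      (range modelN) y = (mfderiv modelN (𝓡 2) (Prod.snd : N → S2)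
        ((extChartAt modelN p).symm y)).comp
      (mfderivWithin 𝓘(ℝ, E₁ × E₂) modelN (extChartAt modelN p).symm (range modelN) y) :=
    mfderiv_comp_mfderivWithin y (mdifferentiableAt_snd)
      (mdifferentiableWithinAt_extChartAt_symm hy) hu
  have h2 : ((Prod.snd : N → S2) ∘ (extChartAt modelN p).symm)
      = (extChartAt (𝓡 2) p.2).symm ∘ (Prod.snd : E₁ × E₂ → E₂) := funext (snd_symm p)
  have h3 : mfderivWithin 𝓘(ℝ, E₁ × E₂) (𝓡 2)
      ((extChartAt (𝓡 2) p.2).symm ∘ (Prod.snd : E₁ × E₂ → E₂)) (range modelN) y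
      = (mfderivWithin 𝓘(ℝ, E₂) (𝓡 2) (extChartAt (𝓡 2) p.2).symm (range (𝓡 2)) y.2).comp
        (mfderivWithin 𝓘(ℝ, E₁ × E₂) 𝓘(ℝ, E₂) (Prod.snd : E₁ × E₂ → E₂) (range modelN) y) :=
    mfderivWithin_comp y (mdifferentiableWithinAt_extChartAt_symm (mem_target_cylinder hy).2)
      (mdifferentiableWithinAt_iff_differentiableWithinAt.2 differentiableWithinAt_snd)
      (by simp) hu
  rw [mfderivWithin_eq_fderivWithin,
    hasFDerivWithinAt_snd.fderivWithin (modelN.uniqueDiffOn y hr)] at h3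
  have h4 := DFunLike.congr_fun h1 v
  rw [h2, h3] at h4
  exact h4.symm

end Charts

/-! ### Coordinate expressions of the collar metric -/

section CollarCoordinates

open Filter Topology

/-- The metric `h` read in the preferred chart at `x₀`. -/
def coordForm (h : SphereMetric) (x₀ : S2) (z : E₂) : E₂ →L[ℝ] E₂ →L[ℝ] ℝ :=
  let D : E₂ →L[ℝ] E₂ :=
    mfderivWithin 𝓘(ℝ, E₂) (𝓡 2) (extChartAt (𝓡 2) x₀).symm (range (𝓡 2)) z
  let L : E₂ →L[ℝ] E₂ →L[ℝ] ℝ := h.inner ((extChartAt (𝓡 2) x₀).symm z)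
  L.bilinearComp D D

lemma coordForm_apply (h : SphereMetric) (x₀ : S2) (z v w : E₂) :
    coordForm h x₀ z v w = h.inner ((extChartAt (𝓡 2) x₀).symm z)
      (mfderivWithin 𝓘(ℝ, E₂) (𝓡 2) (extChartAt (𝓡 2) x₀).symm (range (𝓡 2)) z v)
      (mfderivWithin 𝓘(ℝ, E₂) (𝓡 2) (extChartAt (𝓡 2) x₀).symm (range (𝓡 2)) z w) := rfl

/-- The orientation sign of the chart enters dt² squared and disappears, so both kinds of chart of
[0,1] give the same block form. -/
lemma collarForm_symm (g : ℝ → SphereMetric) (m ro k A : ℝ) {p : N} {y : E₁ × E₂}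
    (hy : y ∈ (extChartAt modelN p).target) (v w : E₁ × E₂) :
    collarForm g m ro k A ((extChartAt modelN p).symm y)
      (mfderivWithin 𝓘(ℝ, E₁ × E₂) modelN (extChartAt modelN p).symm (range modelN) y v)
      (mfderivWithin 𝓘(ℝ, E₁ × E₂) modelN (extChartAt modelN p).symm (range modelN) y w)
    = A ^ 2 * (v.1 0 * w.1 0)
      + ro⁻¹ ^ 2 * uProfile m ro (A * k * chartTime p.1 y.1) ^ 2 *
        coordForm (g (chartTime p.1 y.1)) p.2 y.2 v.2 w.2 := by
  have h1 : (((extChartAt modelN p).symm y).1 : ℝ) = chartTime p.1 y.1 := coe_fst_symm hy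
  unfold collarForm
  simp only [mfderiv_timeFn_symm hy, mfderiv_snd_symm hy, h1, coordForm_apply]
  have := chartSign_sq p.1
  congr 1
  linear_combination A ^ 2 * v.1 0 * w.1 0 * this

/-- The coordinate metric of `g(t)` in the preferred chart at `x₀`. -/
def pathCoord (g : ℝ → SphereMetric) (x₀ : S2) (t : ℝ) (z : E₂) : Matrix (Fin 2) (Fin 2) ℝ :=
  coordMetric (𝓡 2) basisS (sphereForm (g t)) x₀ z

/-- The conformal factor of the slices. -/
def conf (m ro k A t : ℝ) : ℝ := ro⁻¹ ^ 2 * uProfile m ro (A * k * t) ^ 2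

/-- The slice metrics of the collar in the preferred chart at `p`. -/
def sliceCoord (g : ℝ → SphereMetric) (m ro k A : ℝ) (p : N) (y : E₁ × E₂) :
    Matrix (Fin 2) (Fin 2) ℝ :=
  Matrix.of fun a c => conf m ro k A (chartTime p.1 y.1) *
    pathCoord g p.2 (chartTime p.1 y.1) y.2 a c

lemma basisN_inl (i : Fin 1) : basisN (Sum.inl i) = (EuclideanSpace.single i 1, 0) := by
  simp

lemma basisN_inr (a : Fin 2) : basisN (Sum.inr a) = (0, basisS a) := by
  simp

lemma coordMetric_collar {g : ℝ → SphereMetric} {m ro k A : ℝ} {γ : CylinderForm}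
    (hγ : γ = collarForm g m ro k A) {p : N} {y : E₁ × E₂}
    (hy : y ∈ (extChartAt modelN p).target) :
    coordMetric modelN basisN γ p y = blockMetric A (sliceCoord g m ro k A p) y := by
  subst hγ
  ext i j
  simp only [coordMetric, Matrix.of_apply]
  rw [collarForm_symm g m ro k A hy]
  rcases i with i | i <;> rcases j with j | j
  · rw [basisN_inl, basisN_inl, Subsingleton.elim i 0, Subsingleton.elim j 0]
    simp [blockMetric]
  · rw [basisN_inl, basisN_inr]
    simp [blockMetric]
  · rw [basisN_inl, basisN_inr]
    simp [blockMetric]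
  · rw [basisN_inr, basisN_inr]
    simp only [PiLp.zero_apply, mul_zero, zero_add]
    rfl

lemma coordMetric_collar_eventuallyEq {g : ℝ → SphereMetric} {m ro k A : ℝ} {γ : CylinderForm}
    (hγ : γ = collarForm g m ro k A) (p : N) :
    coordMetric modelN basisN γ p =ᶠ[𝓝[range modelN] (extChartAt modelN p p)]
      blockMetric A (sliceCoord g m ro k A p) := by
  filter_upwards [extChartAt_target_mem_nhdsWithin p] with y hy using coordMetric_collar hγ hy

end CollarCoordinates

/-! ### Smoothness of the collar metric -/

section Bundles

open Filter Topology

variable {E H M : Type*} [NormedAddCommGroup E] [NormedSpace ℝ E] [TopologicalSpace H]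
  [TopologicalSpace M] [ChartedSpace H M] {I : ModelWithCorners ℝ E H} [IsManifold I 1 M]

/-- A bilinear form on a tangent space in the trivialization given by a chart. -/
lemma inCoordinates_bilin {x₀ x : M} (hx : x ∈ (chartAt H x₀).source)
    (φ : TangentSpace I x →L[ℝ] TangentSpace I x →L[ℝ] ℝ) (v w : E) :
    ContinuousLinearMap.inCoordinates E (TangentSpace I) (E →L[ℝ] ℝ)
      (fun x : M => TangentSpace I x →L[ℝ] ℝ) x₀ x x₀ x φ v w
      = (φ : E →L[ℝ] E →L[ℝ] ℝ)
        (mfderivWithin 𝓘(ℝ, E) I (extChartAt I x₀).symm (range I) (extChartAt I x₀ x) v)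
        (mfderivWithin 𝓘(ℝ, E) I (extChartAt I x₀).symm (range I) (extChartAt I x₀ x) w) := by
  have hb : x ∈ (trivializationAt E (TangentSpace I) x₀).baseSet := by
    rwa [TangentBundle.trivializationAt_baseSet]
  have h2 := TangentBundle.symmL_trivializationAt (I := I) (𝕜 := ℝ) hx
  have h3 := inCoordinates_apply_eq₂ (E₃ := Bundle.Trivial M ℝ) (F₃ := ℝ) (𝕜 := ℝ) (ϕ := φ)
    (v := v) (w := w) hb hb (Set.mem_univ _)
  have h4 : ∀ u, (trivializationAt E (TangentSpace I) x₀).symm x u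
      = (mfderivWithin 𝓘(ℝ, E) I (extChartAt I x₀).symm (range I) (extChartAt I x₀ x) u : E) :=
    fun u => (Trivialization.symmL_apply (R := ℝ) _ hb u).symm.trans (DFunLike.congr_fun h2 u)
  rw [h4, h4] at h3
  exact h3.trans (by simp)

/-- The unit ball of a positive definite form on a finite dimensional space is bounded. -/
lemma isVonNBounded_of_pos [FiniteDimensional ℝ E] (L : E →L[ℝ] E →L[ℝ] ℝ)
    (hL : ∀ v, v ≠ 0 → 0 < L v v) : Bornology.IsVonNBounded ℝ {v : E | L v v < 1} := by
  have : ProperSpace E := FiniteDimensional.proper ℝ E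
  -- Compactness of the unit sphere gives L v v ≥ c ‖v‖² with c > 0, hence the radius (1/c)^(1/2)
  -- below.
  obtain ⟨c, hc, h⟩ := (isCompact_sphere (0 : E) 1).exists_forall_le'
    (f := fun v => L v v) (a := 0)
    (L.continuous.clm_apply continuous_id).continuousOn fun v hv => hL v (by
      rintro rfl; simp at hv)
  rw [NormedSpace.isVonNBounded_iff, isBounded_iff_forall_norm_le]
  refine ⟨Real.sqrt (1 / c), fun v hv => ?_⟩
  apply Real.le_sqrt_of_sq_le
  rw [le_div_iff₀ hc]
  rcases eq_or_ne v 0 with rfl | hv0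
  · simp
  have hn := norm_pos_iff.2 hv0
  have h1 := h (‖v‖⁻¹ • v) (by simp [norm_smul, hn.ne'])
  simp only [map_smul, smul_apply, smul_eq_mul] at h1
  have h2 : ‖v‖ ^ 2 * c ≤ L v v := by
    calc ‖v‖ ^ 2 * c ≤ ‖v‖ ^ 2 * (‖v‖⁻¹ * (‖v‖⁻¹ * L v v)) := by gcongr
      _ = L v v := by field_simp
  have h3 : L v v < 1 := hv
  linarith

end Bundles

/-! ### The collar form is a smooth Riemannian metric -/

section SmoothCollar

open Filter Topology

set_option synthInstance.maxHeartbeats 200000 in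
instance bilinNormedGroup : NormedAddCommGroup (E₂ →L[ℝ] E₂ →L[ℝ] ℝ) := inferInstance

set_option synthInstance.maxHeartbeats 200000 in
instance bilinNormedSpace : NormedSpace ℝ (E₂ →L[ℝ] E₂ →L[ℝ] ℝ) := inferInstance

set_option synthInstance.maxHeartbeats 200000 in
instance bilinNormedGroupProd :
    NormedAddCommGroup ((E₁ × E₂) →L[ℝ] (E₁ × E₂) →L[ℝ] ℝ) := inferInstance

set_option synthInstance.maxHeartbeats 200000 in
instance bilinNormedSpaceProd :
    NormedSpace ℝ ((E₁ × E₂) →L[ℝ] (E₁ × E₂) →L[ℝ] ℝ) := inferInstance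

/-- Links smoothness of a section of the bundle of bilinear forms to ordinary smoothness of
`coordForm` on a vector space. -/
lemma inCoordinates_inner (h : SphereMetric) {x₀ x : S2} (hx : x ∈ (chartAt E₂ x₀).source) :
    ContinuousLinearMap.inCoordinates E₂ (TangentSpace (𝓡 2)) (E₂ →L[ℝ] ℝ)
      (fun x : S2 => TangentSpace (𝓡 2) x →L[ℝ] ℝ) x₀ x x₀ x (h.inner x)
      = coordForm h x₀ (extChartAt (𝓡 2) x₀ x) := by
  ext v w
  have h1 : (extChartAt (𝓡 2) x₀).symm (extChartAt (𝓡 2) x₀ x) = x :=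
    (extChartAt (𝓡 2) x₀).left_inv (by rwa [extChartAt_source])
  have h2 : ∀ x' : S2, x' = x → ∀ a c : E₂, (h.inner x' : E₂ →L[ℝ] E₂ →L[ℝ] ℝ) a c
      = (h.inner x : E₂ →L[ℝ] E₂ →L[ℝ] ℝ) a c := by rintro _ rfl _ _; rfl
  exact (inCoordinates_bilin hx _ v w).trans (h2 _ h1 _ _).symm

set_option synthInstance.maxHeartbeats 200000 in
/-- A smooth path of metrics is smooth in the charts. -/
lemma contDiffOn_coordForm {g : ℝ → SphereMetric} (hg : IsSmoothPath g) (x₀ : S2) :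
    ContDiffOn ℝ ∞ (fun q : ℝ × E₂ => coordForm (g q.1) x₀ q.2)
      (Icc 0 1 ×ˢ (extChartAt (𝓡 2) x₀).target) := by
  set χ := extChartAt (𝓡 2) x₀
  have h1 : ContMDiffOn 𝓘(ℝ, ℝ × E₂) (𝓘(ℝ, ℝ).prod (𝓡 2)) ∞
      (fun q : ℝ × E₂ => ((q.1, χ.symm q.2) : ℝ × S2)) (Icc 0 1 ×ˢ χ.target) := by
    rw [modelWithCornersSelf_prod, ← chartedSpaceSelf_prod]
    exact contMDiff_fst.contMDiffOn.prodMk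
      ((contMDiffOn_extChartAt_symm x₀).comp contMDiff_snd.contMDiffOn fun q hq => hq.2)
  have h2 := hg.comp h1 (fun q hq => ⟨hq.1, mem_univ _⟩)
  rw [← contMDiffOn_iff_contDiffOn]
  have hsrc : ∀ q ∈ Icc (0 : ℝ) 1 ×ˢ χ.target, χ.symm q.2 ∈ (chartAt E₂ x₀).source :=
    fun q hq => by
      rw [← extChartAt_source (𝓡 2)]; exact χ.map_target hq.2
  have h3 := ((trivializationAt (E₂ →L[ℝ] E₂ →L[ℝ] ℝ)
    (fun x : S2 => TangentSpace (𝓡 2) x →L[ℝ] TangentSpace (𝓡 2) x →L[ℝ] ℝ) x₀).contMDiffOn_iff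
      (IB := 𝓡 2) (IM := 𝓘(ℝ, ℝ × E₂)) (n := ∞) (fun q hq => by
        rw [hom_trivializationAt_source]
        simpa using hsrc q hq)).1 h2
  refine h3.2.congr fun q hq => ?_
  have h4 := inCoordinates_inner (g q.1) (hsrc q hq)
  rw [χ.right_inv hq.2] at h4
  exact h4.symm

variable {g : ℝ → SphereMetric} {m ro k A : ℝ}

lemma conf_contDiffOn (hro : 0 < ro) (hm : m ≤ ro / 2) (hA : 0 ≤ A) (hk : 0 ≤ k) :
    ContDiffOn ℝ ∞ (conf m ro k A) (Icc 0 1) := by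
  have h : ContDiffOn ℝ ∞ (fun t : ℝ => uProfile m ro (A * k * t)) (Icc 0 1) :=
    (contDiffOn_uProfile hro hm).comp (contDiff_const.mul contDiff_id).contDiffOn
      fun t ht => mul_nonneg (mul_nonneg hA hk) ht.1
  exact contDiffOn_const.mul (h.pow 2)

lemma conf_pos (hro : 0 < ro) (hm : m ≤ ro / 2) (hA : 0 ≤ A) (hk : 0 ≤ k) {t : ℝ} (ht : 0 ≤ t) :
    0 < conf m ro k A t := by
  have := hro.trans_le (uProfile_ge hro hm (mul_nonneg (mul_nonneg hA hk) ht))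
  unfold conf
  positivity

lemma mfderiv_timeFn (p : N) (v : E₁ × E₂) :
    (mfderiv modelN 𝓘(ℝ, ℝ) timeFn p v : ℝ) = chartSign p.1 * v.1 0 := by
  have h := mfderiv_timeFn_symm (mem_extChartAt_target (I := modelN) p) v
  have h1 : (extChartAt modelN p).symm (extChartAt modelN p p) = p := extChartAt_to_inv p
  have h2 : ∀ q : N, q = p → ∀ u : E₁ × E₂, (mfderiv modelN 𝓘(ℝ, ℝ) timeFn q u : ℝ)
      = mfderiv modelN 𝓘(ℝ, ℝ) timeFn p u := by rintro _ rfl _; rfl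
  rw [mfderivWithin_range_extChartAt_symm] at h
  exact (h2 _ h1 v).symm.trans h

lemma collarForm_apply (p : N) (v w : E₁ × E₂) :
    collarForm g m ro k A p v w = A ^ 2 * (v.1 0 * w.1 0) + conf m ro k A p.1 *
      ((g p.1).inner p.2 : E₂ →L[ℝ] E₂ →L[ℝ] ℝ) v.2 w.2 := by
  unfold collarForm
  simp only [mfderiv_timeFn, mfderiv_snd]
  have := chartSign_sq p.1
  refine congrArg₂ (· + ·) ?_ rfl
  linear_combination A ^ 2 * v.1 0 * w.1 0 * this

/-- The bilinear map underlying the collar metric. -/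
def collarBilin (g : ℝ → SphereMetric) (m ro k A : ℝ) (p : N) :
    (E₁ × E₂) →L[ℝ] (E₁ × E₂) →L[ℝ] ℝ :=
  let e : (E₁ × E₂) →L[ℝ] ℝ := (EuclideanSpace.proj 0 : E₁ →L[ℝ] ℝ).comp
    (ContinuousLinearMap.fst ℝ E₁ E₂)
  let h : E₂ →L[ℝ] E₂ →L[ℝ] ℝ := (g p.1).inner p.2
  A ^ 2 • (ContinuousLinearMap.mul ℝ ℝ).bilinearComp e e + conf m ro k A p.1 •
    h.bilinearComp (ContinuousLinearMap.snd ℝ E₁ E₂) (ContinuousLinearMap.snd ℝ E₁ E₂)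

lemma collarBilin_apply (p : N) (v w : E₁ × E₂) :
    collarBilin g m ro k A p v w = collarForm g m ro k A p v w := by
  rw [collarForm_apply]; rfl

lemma collarBilin_symm (p : N) (v w : E₁ × E₂) :
    collarBilin g m ro k A p v w = collarBilin g m ro k A p w v := by
  rw [collarBilin_apply, collarBilin_apply, collarForm_apply, collarForm_apply, mul_comm (v.1 0)]
  exact congrArg _ (congrArg _ ((g p.1).symm p.2 v.2 w.2))

lemma collarBilin_pos (hro : 0 < ro) (hm : m ≤ ro / 2) (hA : 0 < A) (hk : 0 ≤ k) (p : N)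
    (v : E₁ × E₂) (hv : v ≠ 0) : 0 < collarBilin g m ro k A p v v := by
  rw [collarBilin_apply, collarForm_apply]
  have hc : 0 < conf m ro k A p.1 := conf_pos hro hm hA.le hk p.1.2.1
  have key : ∀ L : E₂ →L[ℝ] E₂ →L[ℝ] ℝ, (v.2 ≠ 0 → 0 < L v.2 v.2) →
      0 < A ^ 2 * (v.1 0 * v.1 0) + conf m ro k A p.1 * L v.2 v.2 := fun L hL => by
    by_cases h : v.2 = 0
    · have h1 : v.1 0 ≠ 0 := fun h0 => hv (Prod.ext (by
        ext i; rw [Subsingleton.elim i 0]; exact h0) h)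
      have : 0 < v.1 0 * v.1 0 := mul_self_pos.2 h1
      rw [h, map_zero, mul_zero, add_zero]
      positivity
    · have := mul_pos hc (hL h)
      have h3 := mul_self_nonneg (v.1 0)
      positivity
  exact key _ ((g p.1).pos p.2 v.2)

/-- Pull-back of bilinear forms under the projection `E₁ × E₂ → E₂`. -/
def pullSnd : (E₂ →L[ℝ] E₂ →L[ℝ] ℝ) →L[ℝ] ((E₁ × E₂) →L[ℝ] (E₁ × E₂) →L[ℝ] ℝ) :=
  let q := ContinuousLinearMap.snd ℝ E₁ E₂
  ((ContinuousLinearMap.compL ℝ (E₁ × E₂) E₂ ((E₁ × E₂) →L[ℝ] ℝ)).flip q).comp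
    (ContinuousLinearMap.compL ℝ E₂ (E₂ →L[ℝ] ℝ) ((E₁ × E₂) →L[ℝ] ℝ)
      ((ContinuousLinearMap.compL ℝ (E₁ × E₂) E₂ ℝ).flip q))

/-- The bilinear form `dt²` in coordinates. -/
def timeSq : (E₁ × E₂) →L[ℝ] (E₁ × E₂) →L[ℝ] ℝ :=
  let e : (E₁ × E₂) →L[ℝ] ℝ := (EuclideanSpace.proj 0 : E₁ →L[ℝ] ℝ).comp
    (ContinuousLinearMap.fst ℝ E₁ E₂)
  (ContinuousLinearMap.mul ℝ ℝ).bilinearComp e e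

/-- In the trivialization the collar form is a constant plus a scalar function times a fixed linear
image of `coordForm`; smoothness then reduces to that of the factor and of the path. -/
lemma inCoordinates_collar {p₀ p : N}
    (hp : p ∈ (chartAt (ModelProd (EuclideanHalfSpace 1) E₂) p₀).source) :
    ContinuousLinearMap.inCoordinates (E₁ × E₂) (TangentSpace modelN) ((E₁ × E₂) →L[ℝ] ℝ)
      (fun p : N => TangentSpace modelN p →L[ℝ] ℝ) p₀ p p₀ p (collarBilin g m ro k A p)
      = A ^ 2 • timeSq + conf m ro k A p.1 •
        pullSnd (coordForm (g p.1) p₀.2 (extChartAt (𝓡 2) p₀.2 p.2)) := by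
  have hs : p ∈ (extChartAt modelN p₀).source := by rwa [extChartAt_source]
  have hy : extChartAt modelN p₀ p ∈ (extChartAt modelN p₀).target :=
    (extChartAt modelN p₀).map_source hs
  have h1 : (extChartAt modelN p₀).symm (extChartAt modelN p₀ p) = p :=
    (extChartAt modelN p₀).left_inv hs
  have h2 : ∀ q : N, q = p → ∀ a c : E₁ × E₂, collarBilin g m ro k A p a c
      = collarForm g m ro k A q a c := by rintro _ rfl _ _; exact collarBilin_apply _ _ _
  have h3 : chartTime p₀.1 (extChartAt modelN p₀ p).1 = p.1 := by
    rw [← coe_fst_symm hy, h1]; rfl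
  have h5 : (extChartAt modelN p₀ p).2 = extChartAt (𝓡 2) p₀.2 p.2 := by
    rw [extChartAt_cylinder]; rfl
  refine ContinuousLinearMap.ext fun v => ContinuousLinearMap.ext fun w => ?_
  have h4 := collarForm_symm g m ro k A hy v w
  rw [h3, h5] at h4
  exact (inCoordinates_bilin hp _ v w).trans ((h2 _ h1 _ _).trans h4)

lemma contMDiff_collarBilin (hg : IsSmoothPath g) (hro : 0 < ro) (hm : m ≤ ro / 2) (hA : 0 ≤ A)
    (hk : 0 ≤ k) :
    ContMDiff modelN (modelN.prod 𝓘(ℝ, (E₁ × E₂) →L[ℝ] (E₁ × E₂) →L[ℝ] ℝ)) ∞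
      (fun p : N => (TotalSpace.mk' ((E₁ × E₂) →L[ℝ] (E₁ × E₂) →L[ℝ] ℝ) p
        (collarBilin g m ro k A p) : TotalSpace ((E₁ × E₂) →L[ℝ] (E₁ × E₂) →L[ℝ] ℝ)
        (fun p : N => TangentSpace modelN p →L[ℝ] TangentSpace modelN p →L[ℝ] ℝ))) := by
  intro p₀
  refine (contMDiffAt_section (E := fun p : N => TangentSpace modelN p →L[ℝ]
    TangentSpace modelN p →L[ℝ] ℝ) p₀).2 ?_
  have hsrc : (chartAt (ModelProd (EuclideanHalfSpace 1) E₂) p₀).source ∈ 𝓝 p₀ :=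
    chart_source_mem_nhds _ p₀
  have ht : ContMDiffAt modelN 𝓘(ℝ, ℝ) ∞ (fun p : N => (p.1 : ℝ)) p₀ :=
    ((contMDiff_subtypeVal_Icc (x := 0) (y := 1)).comp contMDiff_fst) p₀
  have hconf : ContMDiffAt modelN 𝓘(ℝ, ℝ) ∞ (fun p : N => conf m ro k A p.1) p₀ :=
    ((conf_contDiffOn hro hm hA hk).contMDiffOn.comp_contMDiff
      ((contMDiff_subtypeVal_Icc (x := 0) (y := 1)).comp contMDiff_fst) fun p : N => p.1.2) p₀
  have hx : ContMDiffAt modelN 𝓘(ℝ, E₂) ∞ (fun p : N => extChartAt (𝓡 2) p₀.2 p.2) p₀ :=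
    (contMDiffAt_extChartAt (I := 𝓡 2) (x := p₀.2)).comp p₀ contMDiffAt_snd
  have hform : ContMDiffAt modelN 𝓘(ℝ, E₂ →L[ℝ] E₂ →L[ℝ] ℝ) ∞
      (fun p : N => coordForm (g p.1) p₀.2 (extChartAt (𝓡 2) p₀.2 p.2)) p₀ := by
    -- The coordinate path is smooth only within [0,1] × target, so the composition is taken within
    -- sets and the restriction is removed afterwards.
    rw [← contMDiffWithinAt_univ] at ht hx
    have hmem : ∀ᶠ p : N in 𝓝 p₀, ((p.1 : ℝ), extChartAt (𝓡 2) p₀.2 p.2) ∈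
        Icc (0 : ℝ) 1 ×ˢ (extChartAt (𝓡 2) p₀.2).target := by
      have : ∀ᶠ p : N in 𝓝 p₀, p.2 ∈ (extChartAt (𝓡 2) p₀.2).source :=
        continuous_snd.continuousAt.eventually_mem (extChartAt_source_mem_nhds p₀.2)
      filter_upwards [this] with p hp
      exact ⟨p.1.2, (extChartAt (𝓡 2) p₀.2).map_source hp⟩
    have h1 := (contDiffOn_coordForm hg p₀.2 (((p₀.1 : ℝ), extChartAt (𝓡 2) p₀.2 p₀.2))
      hmem.self_of_nhds).contMDiffWithinAt
    have h2 : ContMDiffWithinAt modelN 𝓘(ℝ, ℝ × E₂) ∞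
        (fun p : N => ((p.1 : ℝ), extChartAt (𝓡 2) p₀.2 p.2)) univ p₀ := ht.prodMk_space hx
    exact (ContMDiffWithinAt.comp' p₀ h1 h2).contMDiffAt
      (by filter_upwards [hmem] with p hp using ⟨mem_univ _, hp⟩)
  have hpull : ContMDiffAt modelN 𝓘(ℝ, (E₁ × E₂) →L[ℝ] (E₁ × E₂) →L[ℝ] ℝ) ∞
      (fun p : N => pullSnd (coordForm (g p.1) p₀.2 (extChartAt (𝓡 2) p₀.2 p.2))) p₀ :=
    (pullSnd.contMDiff.contMDiffAt).comp p₀ hform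
  refine ContMDiffAt.congr_of_eventuallyEq
    ((contMDiffAt_const (c := A ^ 2 • timeSq)).add (hconf.smul hpull)) ?_
  filter_upwards [hsrc] with p hp
  exact inCoordinates_collar hp

/-- The collar metric. -/
def collarMetric (hg : IsSmoothPath g) (hro : 0 < ro) (hm : m ≤ ro / 2) (hA : 0 < A)
    (hk : 0 ≤ k) : CylinderMetric where
  inner p := collarBilin g m ro k A p
  symm p v w := collarBilin_symm p v w
  pos p v hv := collarBilin_pos hro hm hA hk p v hv
  isVonNBounded p := isVonNBounded_of_pos (E := E₁ × E₂) _ (collarBilin_pos hro hm hA hk p)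
  contMDiff := contMDiff_collarBilin hg hro hm hA.le hk

end SmoothCollar

/-! ### Coordinate derivatives on the cylinder -/

section Slicing

open Filter Topology

variable {p : N} {y : E₁ × E₂} {f : E₁ × E₂ → ℝ}

lemma pd_inr_eq (hy : y ∈ range modelN) (hf : DifferentiableWithinAt ℝ f (range modelN) y)
    (a : Fin 2) :
    pd modelN basisN (Sum.inr a) f y = pd (𝓡 2) basisS a (fun z => f (y.1, z)) y.2 := by
  have hr : range modelN = range (𝓡∂ 1) ×ˢ range (𝓡 2) := ModelWithCorners.range_prod
  have hj : HasFDerivWithinAt (fun z : E₂ => (y.1, z)) (ContinuousLinearMap.inr ℝ E₁ E₂)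
      (range (𝓡 2)) y.2 := (hasFDerivAt_prodMk_right y.1 y.2).hasFDerivWithinAt
  have h := HasFDerivWithinAt.comp (g := f) (f := fun z : E₂ => (y.1, z)) y.2
    (t := range modelN) hf.hasFDerivWithinAt hj
    (fun z hz => by rw [hr] at hy ⊢; exact ⟨hy.1, hz⟩)
  unfold pd
  have h' := h.fderivWithin ((𝓡 2).uniqueDiffOn y.2 (by simp))
  have e : (fun z => f (y.1, z)) = f ∘ fun z : E₂ => (y.1, z) := rfl
  rw [e, h', basisN_inr]
  rfl

/-- The values of f are needed only on the line through y along which the second coordinate is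
fixed. That suffices for quantities known in terms of g' only at the centre of the sphere chart. The
derivative within [0,1] covers the two ends. -/
lemma pd_inl_eq {ψ : ℝ → ℝ} {ψ' : ℝ} (hy : y ∈ (extChartAt modelN p).target)
    (hf : DifferentiableWithinAt ℝ f (range modelN) y)
    (hψ : ∀ z ∈ (extChartAt (𝓡∂ 1) p.1).target, f (z, y.2) = ψ (chartTime p.1 z))
    (hψ' : HasDerivWithinAt ψ ψ' (Icc 0 1) (chartTime p.1 y.1)) :
    pd modelN basisN (Sum.inl 0) f y = chartSign p.1 * ψ' := by
  have hr : range modelN = range (𝓡∂ 1) ×ˢ range (𝓡 2) := ModelWithCorners.range_prod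
  have hy' : y ∈ range modelN := extChartAt_target_subset_range p hy
  have hy1 := (mem_target_cylinder hy).1
  have hnhds := extChartAt_target_mem_nhdsWithin_of_mem hy1
  have hu : UniqueDiffWithinAt ℝ (range (𝓡∂ 1)) y.1 :=
    (𝓡∂ 1).uniqueDiffOn y.1 (extChartAt_target_subset_range _ hy1)
  have hj : HasFDerivWithinAt (fun z : E₁ => (z, y.2)) (ContinuousLinearMap.inl ℝ E₁ E₂)
      (range (𝓡∂ 1)) y.1 := (hasFDerivAt_prodMk_left y.1 y.2).hasFDerivWithinAt
  have h := HasFDerivWithinAt.comp (g := f) (f := fun z : E₁ => (z, y.2)) y.1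
    (t := range modelN) hf.hasFDerivWithinAt hj
    (fun z hz => by rw [hr] at hy' ⊢; exact ⟨hz, hy'.2⟩)
  have h2 : HasFDerivWithinAt (ψ ∘ chartTime p.1)
      (ψ' • (chartSign p.1 • (EuclideanSpace.proj 0 : E₁ →L[ℝ] ℝ)))
      (extChartAt (𝓡∂ 1) p.1).target y.1 :=
    hψ'.comp_hasFDerivWithinAt y.1 (chartTime_hasFDerivAt p.1 y.1).hasFDerivWithinAt
      fun z hz => by rw [← coe_extChartAt_Icc_symm p.1 hz]; exact Subtype.prop _
  have h3 : HasFDerivWithinAt (f ∘ fun z : E₁ => (z, y.2))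
      (ψ' • (chartSign p.1 • (EuclideanSpace.proj 0 : E₁ →L[ℝ] ℝ))) (range (𝓡∂ 1)) y.1 :=
    (h2.mono_of_mem_nhdsWithin hnhds).congr_of_eventuallyEq
      (by filter_upwards [hnhds] with z hz using hψ z hz) (hψ _ hy1)
  have h4 := DFunLike.congr_fun (hu.eq h h3) (EuclideanSpace.single (0 : Fin 1) (1 : ℝ))
  unfold pd
  rw [basisN_inl]
  refine h4.trans ?_
  simp [mul_comm]

/-- Functions of `(t, x)` are smooth in the charts of the cylinder. -/
lemma smoothIn_chart {φ : ℝ × E₂ → ℝ}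
    (hφ : ContDiffOn ℝ ∞ φ (Icc 0 1 ×ˢ (extChartAt (𝓡 2) p.2).target))
    (hy : y ∈ (extChartAt modelN p).target) :
    SmoothIn modelN (fun y => φ (chartTime p.1 y.1, y.2)) y := by
  have hmaps : MapsTo (fun y : E₁ × E₂ => (chartTime p.1 y.1, y.2)) (extChartAt modelN p).target
      (Icc 0 1 ×ˢ (extChartAt (𝓡 2) p.2).target) := fun z hz =>
    ⟨by
      change chartTime p.1 z.1 ∈ _
      rw [← coe_fst_symm hz]; exact Subtype.prop _, (mem_target_cylinder hz).2⟩
  have h : ContDiff ℝ ∞ (fun y : E₁ × E₂ => (chartTime p.1 y.1, y.2)) :=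
    ((chartTime_contDiff p.1).comp contDiff_fst).prodMk contDiff_snd
  exact ((hφ.comp h.contDiffOn hmaps) y hy).mono_of_mem_nhdsWithin
    (extChartAt_target_mem_nhdsWithin_of_mem hy)

end Slicing

/-! ### The path g(t) and the conformal factor in coordinates -/

section SliceMetrics

open Filter Topology

variable {g : ℝ → SphereMetric} {m ro k A : ℝ}

lemma pathCoord_apply (g : ℝ → SphereMetric) (x₀ : S2) (t : ℝ) (z : E₂) (a c : Fin 2) :
    pathCoord g x₀ t z a c = coordForm (g t) x₀ z (basisS a) (basisS c) := rfl

lemma pathCoord_symm (g : ℝ → SphereMetric) (x₀ : S2) (t : ℝ) (z : E₂) (a c : Fin 2) :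
    pathCoord g x₀ t z a c = pathCoord g x₀ t z c a := (g t).symm _ _ _

/-- At its own centre the derivative of the inverse chart is the identity, so the coordinate frame
is the basis used for traces, norms and areas. -/
lemma pathCoord_center (g : ℝ → SphereMetric) (x : S2) (t : ℝ) :
    pathCoord g x t (extChartAt (𝓡 2) x x)
      = gram basisS (fun v w : E₂ => (g t).inner x v w) := by
  ext a c
  have h1 : (extChartAt (𝓡 2) x).symm (extChartAt (𝓡 2) x x) = x := extChartAt_to_inv x
  have h2 : ∀ x' : S2, x' = x → ∀ a c : E₂, ((g t).inner x' : E₂ →L[ℝ] E₂ →L[ℝ] ℝ) a c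
      = ((g t).inner x : E₂ →L[ℝ] E₂ →L[ℝ] ℝ) a c := by rintro _ rfl _ _; rfl
  rw [pathCoord_apply, coordForm_apply, mfderivWithin_range_extChartAt_symm]
  exact h2 _ h1 _ _

lemma gram_det_pos (h : SphereMetric) (x : S2) :
    0 < (gram basisS (fun v w : E₂ => h.inner x v w)).det := by
  have key : ∀ L : E₂ →L[ℝ] E₂ →L[ℝ] ℝ, (∀ v w, L v w = L w v) → (∀ v, v ≠ 0 → 0 < L v v) →
      0 < (gram basisS (fun v w : E₂ => L v w)).det := fun L hs hp => by
    set e := basisS 0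
    set f := basisS 1
    have he : e ≠ 0 := basisS.ne_zero 0
    have h1 := hp e he
    -- Gram–Schmidt without division: the square of this vector is L(e,e) times the Gram
    -- determinant.
    have h2 : L e e • f - L e f • e ≠ 0 := by
      intro h0
      have h3 := basisS.linearIndependent
      rw [Fintype.linearIndependent_iff] at h3
      have := h3 ![-L e f, L e e] (by
        simp only [Fin.sum_univ_two, Matrix.cons_val_zero, Matrix.cons_val_one]
        rw [← h0, neg_smul]; abel) 1
      simp at this
      exact h1.ne' this
    have h3 := hp _ h2
    simp only [map_sub, map_smul, sub_apply, smul_apply, smul_eq_mul, hs f e] at h3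
    have h4 : 0 < L e e * (L e e * L f f - L e f * L e f) := by linarith
    have h5 := pos_of_mul_pos_right h4 h1.le
    rw [Matrix.det_fin_two]
    change 0 < L e e * L f f - L e f * L f e
    rwa [hs f e]
  exact key (h.inner x) (h.symm x) (h.pos x)

lemma contDiffOn_pathCoord (hg : IsSmoothPath g) (x₀ : S2) (a c : Fin 2) :
    ContDiffOn ℝ ∞ (fun q : ℝ × E₂ => pathCoord g x₀ q.1 q.2 a c)
      (Icc 0 1 ×ˢ (extChartAt (𝓡 2) x₀).target) :=
  ((contDiffOn_coordForm hg x₀).clm_apply contDiffOn_const).clm_apply contDiffOn_const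

lemma smoothIn_pathCoord (hg : IsSmoothPath g) (x₀ : S2) {t : ℝ} (ht : t ∈ Icc (0 : ℝ) 1)
    {z : E₂} (hz : z ∈ (extChartAt (𝓡 2) x₀).target) (a c : Fin 2) :
    SmoothIn (𝓡 2) (fun z => pathCoord g x₀ t z a c) z := by
  have h : ContDiffOn ℝ ∞ (fun z => pathCoord g x₀ t z a c) (extChartAt (𝓡 2) x₀).target :=
    (contDiffOn_pathCoord hg x₀ a c).comp (contDiff_const.prodMk contDiff_id).contDiffOn
      fun z hz => ⟨ht, hz⟩
  exact (h z hz).mono_of_mem_nhdsWithin (extChartAt_target_mem_nhdsWithin_of_mem hz)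

lemma smoothIn_sliceCoord (hg : IsSmoothPath g) (hro : 0 < ro) (hm : m ≤ ro / 2) (hA : 0 ≤ A)
    (hk : 0 ≤ k) {p : N} {y : E₁ × E₂} (hy : y ∈ (extChartAt modelN p).target) (a c : Fin 2) :
    SmoothIn modelN (fun z => sliceCoord g m ro k A p z a c) y :=
  smoothIn_chart (φ := fun q => conf m ro k A q.1 * pathCoord g p.2 q.1 q.2 a c)
    (((conf_contDiffOn hro hm hA hk).comp contDiff_fst.contDiffOn fun _ hq => hq.1).mul
      (contDiffOn_pathCoord hg p.2 a c)) hy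

/-- The derivative in `t` of the metrics in coordinates. -/
lemma pathCoord_hasDerivWithinAt (hg : IsSmoothPath g) (x : S2) {t : ℝ} (ht : t ∈ Icc (0 : ℝ) 1)
    (a c : Fin 2) :
    HasDerivWithinAt (fun s => pathCoord g x s (extChartAt (𝓡 2) x x) a c)
      (gram basisS (fun v w : E₂ => velocity g t x v w) a c) (Icc 0 1) t := by
  have h : ContDiffOn ℝ ∞ (fun s => pathCoord g x s (extChartAt (𝓡 2) x x) a c) (Icc 0 1) :=
    (contDiffOn_pathCoord hg x a c).comp (contDiff_id.prodMk contDiff_const).contDiffOn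
      fun s hs => ⟨hs, mem_extChartAt_target x⟩
  have h1 := ((h t ht).differentiableWithinAt (by simp)).hasDerivWithinAt
  have h2 : derivWithin (fun s => pathCoord g x s (extChartAt (𝓡 2) x x) a c) (Icc 0 1) t
      = gram basisS (fun v w : E₂ => velocity g t x v w) a c := by
    simp only [pathCoord_center]; rfl
  rwa [h2] at h1

/-- The derivative of `log` of the conformal factor, up to a factor of two. -/
def confLog (m ro k A t : ℝ) : ℝ :=
  4 * (A * k) * uSpeed m ro (A * k * t) / uProfile m ro (A * k * t)

variable {t : ℝ}

lemma hasDerivWithinAt_scaled {f : ℝ → ℝ} {f' : ℝ} (hA : 0 ≤ A) (hk : 0 ≤ k)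
    (hf : HasDerivWithinAt f f' (Ici 0) (A * k * t)) :
    HasDerivWithinAt (fun s => f (A * k * s)) (f' * (A * k)) (Icc 0 1) t := by
  have h : HasDerivWithinAt (fun s : ℝ => A * k * s) (A * k) (Icc 0 1) t := by
    simpa using (hasDerivWithinAt_id t (Icc 0 1)).const_mul (A * k)
  exact hf.comp t h fun s hs => mul_nonneg (mul_nonneg hA hk) hs.1

lemma conf_hasDerivWithinAt (hro : 0 < ro) (hm : m ≤ ro / 2) (hA : 0 ≤ A) (hk : 0 ≤ k)
    (ht : t ∈ Icc (0 : ℝ) 1) :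
    HasDerivWithinAt (conf m ro k A) ((1 / 2) * confLog m ro k A t * conf m ro k A t)
      (Icc 0 1) t := by
  have hs : 0 ≤ A * k * t := mul_nonneg (mul_nonneg hA hk) ht.1
  have hu := (hro.trans_le (uProfile_ge hro hm hs)).ne'
  refine (((hasDerivWithinAt_scaled hA hk (uProfile_hasDerivWithinAt hro hm hs)).fun_pow
    2).const_mul (ro⁻¹ ^ 2)).congr_deriv ?_
  unfold confLog conf
  field_simp
  ring

lemma confLog_hasDerivWithinAt (hro : 0 < ro) (hm : m ≤ ro / 2) (hA : 0 ≤ A) (hk : 0 ≤ k)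
    (ht : t ∈ Icc (0 : ℝ) 1) :
    HasDerivWithinAt (confLog m ro k A)
      (4 * (A * k) ^ 2 * (m / uProfile m ro (A * k * t) - uSpeed m ro (A * k * t) ^ 2)
        / uProfile m ro (A * k * t) ^ 2) (Icc 0 1) t := by
  have hs : 0 ≤ A * k * t := mul_nonneg (mul_nonneg hA hk) ht.1
  have hu := (hro.trans_le (uProfile_ge hro hm hs)).ne'
  refine (((hasDerivWithinAt_scaled hA hk (uSpeed_hasDerivWithinAt hro hm hs)).const_mul
    (4 * (A * k))).fun_div (hasDerivWithinAt_scaled hA hk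
      (uProfile_hasDerivWithinAt hro hm hs)) hu).congr_deriv ?_
  field_simp

end SliceMetrics

/-! ### Curvature of the collar metric -/

section CollarCurvature

open Filter Topology

lemma inv_fin_two_smul {c : ℝ} (hc : c ≠ 0) (M : Matrix (Fin 2) (Fin 2) ℝ) (a d : Fin 2) :
    (Matrix.of fun a d => c * M a d)⁻¹ a d = c⁻¹ * M⁻¹ a d := by
  have e : (Matrix.of fun a d => c * M a d) = c • M := rfl
  rw [e]
  by_cases h : IsUnit M.det
  · let := invertibleOfNonzero hc
    rw [Matrix.inv_smul (A := M) c h, invOf_eq_inv]; rfl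
  -- For a singular M both inverses are zero by convention, so the identity persists.
  · have h' : ¬ IsUnit (c • M).det := by
      rw [Matrix.det_smul]
      simp only [isUnit_iff_ne_zero, ne_eq, not_not] at h ⊢
      rw [h, mul_zero]
    rw [Matrix.nonsing_inv_apply_not_isUnit _ h, Matrix.nonsing_inv_apply_not_isUnit _ h']
    simp

/-- The trace of the derivative of a conformal multiple of a path of inner products with trace free
derivative. -/
lemma traceWrt_conformal {h v : Matrix (Fin 2) (Fin 2) ℝ} (hdet : h.det ≠ 0)
    (hs : h 1 0 = h 0 1) (htr : ∑ i, ∑ j, h⁻¹ i j * v i j = 0) (F w : ℝ) :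
    ∑ i, ∑ j, h⁻¹ i j * (w * F * h i j + F * v i j) = 2 * w * F := by
  have hd := inv_mul_cancel₀ hdet
  rw [Matrix.det_fin_two, hs] at hd
  simp only [Matrix.inv_def, Matrix.adjugate_fin_two, Matrix.det_fin_two, Fin.sum_univ_two,
    Matrix.smul_apply, smul_eq_mul, hs, Ring.inverse_eq_inv', Matrix.of_apply,
    Matrix.cons_val_zero, Matrix.cons_val_one, Matrix.cons_val'] at htr ⊢
  linear_combination 2 * w * F * hd + F * htr

/-- The squared norm of the derivative of a conformal multiple of a path of inner products with
trace free derivative. -/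
lemma normSqWrt_conformal {h v : Matrix (Fin 2) (Fin 2) ℝ} (hdet : h.det ≠ 0)
    (hs : h 1 0 = h 0 1) (hv : v 1 0 = v 0 1) (htr : ∑ i, ∑ j, h⁻¹ i j * v i j = 0) (w : ℝ) :
    ∑ i, ∑ j, ∑ k, ∑ l, h⁻¹ i k * h⁻¹ j l * (w * h i j + v i j) * (w * h k l + v k l)
      = 2 * w ^ 2 + ∑ i, ∑ j, ∑ k, ∑ l, h⁻¹ i k * h⁻¹ j l * v i j * v k l := by
  have hd := inv_mul_cancel₀ hdet
  rw [Matrix.det_fin_two, hs] at hd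
  simp only [Matrix.inv_def, Matrix.adjugate_fin_two, Matrix.det_fin_two, Fin.sum_univ_two,
    Matrix.smul_apply, smul_eq_mul, hs, hv, Ring.inverse_eq_inv', Matrix.of_apply,
    Matrix.cons_val_zero, Matrix.cons_val_one, Matrix.cons_val'] at htr ⊢
  generalize (h 0 0 * h 1 1 - h 0 1 * h 0 1)⁻¹ = D at hd htr ⊢
  linear_combination 2 * w ^ 2 * (D * (h 0 0 * h 1 1 - h 0 1 * h 0 1) + 1) * hd
    + 2 * w * D * (h 0 0 * h 1 1 - h 0 1 * h 0 1) * htr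

variable {g : ℝ → SphereMetric} {m ro k A : ℝ}

lemma chartTime_mem {p : N} {y : E₁ × E₂} (hy : y ∈ (extChartAt modelN p).target) :
    chartTime p.1 y.1 ∈ Icc (0 : ℝ) 1 := by
  rw [← coe_fst_symm hy]; exact Subtype.prop _

lemma chartTime_center (p : N) : chartTime p.1 (extChartAt modelN p p).1 = p.1 := by
  rw [← coe_fst_symm (mem_extChartAt_target p), extChartAt_to_inv]; rfl

lemma snd_center (p : N) : (extChartAt modelN p p).2 = extChartAt (𝓡 2) p.2 p.2 := by
  rw [extChartAt_cylinder]; rfl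

lemma pathCoord_center_det (g : ℝ → SphereMetric) (x : S2) (t : ℝ) :
    (pathCoord g x t (extChartAt (𝓡 2) x x)).det ≠ 0 := by
  rw [pathCoord_center]; exact (gram_det_pos (g t) x).ne'

variable (hg : IsSmoothPath g) (hro : 0 < ro) (hm : m ≤ ro / 2) (hA : 0 < A) (hk : 0 ≤ k)
include hg hro hm hA hk

omit hg in
lemma sliceCoord_det_ne_zero {p : N} {y : E₁ × E₂} (hy : y ∈ (extChartAt modelN p).target)
    (hd : (pathCoord g p.2 (chartTime p.1 y.1) y.2).det ≠ 0) :
    (sliceCoord g m ro k A p y).det ≠ 0 := by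
  have hc := conf_pos hro hm hA.le hk (chartTime_mem hy).1
  have e : sliceCoord g m ro k A p y = conf m ro k A (chartTime p.1 y.1) •
    pathCoord g p.2 (chartTime p.1 y.1) y.2 := rfl
  rw [e, Matrix.det_smul]
  exact mul_ne_zero (pow_ne_zero _ hc.ne') hd

omit hg in
lemma sliceCoord_inv {p : N} {y : E₁ × E₂} (hy : y ∈ (extChartAt modelN p).target)
    (a c : Fin 2) : (sliceCoord g m ro k A p y)⁻¹ a c = (conf m ro k A (chartTime p.1 y.1))⁻¹ *
      (pathCoord g p.2 (chartTime p.1 y.1) y.2)⁻¹ a c :=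
  inv_fin_two_smul (conf_pos hro hm hA.le hk (chartTime_mem hy).1).ne' _ a c

lemma pd_inr_sliceCoord {p : N} {y : E₁ × E₂} (hy : y ∈ (extChartAt modelN p).target)
    (i a c : Fin 2) : pd modelN basisN (Sum.inr i) (fun z => sliceCoord g m ro k A p z a c) y
      = conf m ro k A (chartTime p.1 y.1) *
        pd (𝓡 2) basisS i (fun z => pathCoord g p.2 (chartTime p.1 y.1) z a c) y.2 := by
  rw [pd_inr_eq (extChartAt_target_subset_range p hy)
    (smoothIn_sliceCoord hg hro hm hA.le hk hy a c).differentiableWithinAt]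
  change pd (𝓡 2) basisS i (fun z => conf m ro k A (chartTime p.1 y.1) *
    pathCoord g p.2 (chartTime p.1 y.1) z a c) y.2 = _
  exact pd_const_mul (f := fun z => pathCoord g p.2 (chartTime p.1 y.1) z a c) (by simp)
    (conf m ro k A (chartTime p.1 y.1)) (smoothIn_pathCoord hg p.2 (chartTime_mem hy)
    (mem_target_cylinder hy).2 a c).differentiableWithinAt

/-- On a slice the conformal factor is a constant, and it cancels between the inverse metric and the
first derivatives. -/
lemma sliceChristoffel_collar {p : N} {y : E₁ × E₂} (hy : y ∈ (extChartAt modelN p).target)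
    (a c d : Fin 2) : sliceChristoffel modelN basisN (sliceCoord g m ro k A p) a c d y
      = christoffel (𝓡 2) basisS (pathCoord g p.2 (chartTime p.1 y.1)) a c d y.2 := by
  have hc := (conf_pos hro hm hA.le hk (chartTime_mem hy).1).ne'
  simp only [sliceChristoffel, christoffel, pd_inr_sliceCoord hg hro hm hA hk hy,
    sliceCoord_inv hro hm hA hk hy, Fin.sum_univ_two]
  field_simp

omit hg hro hm hA hk in
lemma smoothIn_sliceChristoffel {E H : Type*} [NormedAddCommGroup E] [NormedSpace ℝ E]
    [TopologicalSpace H] {I : ModelWithCorners ℝ E H} {b : Module.Basis (Fin 1 ⊕ Fin 2) ℝ E}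
    {P : E → Matrix (Fin 2) (Fin 2) ℝ} {y : E}
    (hP : ∀ a c, SmoothIn I (fun z => P z a c) y) (hdet : (P y).det ≠ 0) (hy : y ∈ range I)
    (a c d : Fin 2) : SmoothIn I (sliceChristoffel I b P a c d) y := by
  unfold sliceChristoffel
  refine contDiffWithinAt_const.mul (ContDiffWithinAt.sum fun l _ => ?_)
  exact (SmoothIn.inv_entry hP hdet a l).mul
    ((((hP _ _).pd hy).add ((hP _ _).pd hy)).sub ((hP _ _).pd hy))

lemma sliceRiemann_collar (p : N) (a c d l : Fin 2) :
    sliceRiemann modelN basisN (sliceCoord g m ro k A p) a c d l (extChartAt modelN p p)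
      = riemann (𝓡 2) basisS (coordMetric (𝓡 2) basisS (sphereForm (g p.1)) p.2) a c d l
        (extChartAt (𝓡 2) p.2 p.2) := by
  set y := extChartAt modelN p p
  have hy : y ∈ (extChartAt modelN p).target := mem_extChartAt_target p
  have hy' : y ∈ range modelN := extChartAt_target_subset_range p hy
  have ht : chartTime p.1 y.1 = p.1 := chartTime_center p
  have hy2 : y.2 = extChartAt (𝓡 2) p.2 p.2 := snd_center p
  have hdet := sliceCoord_det_ne_zero hro hm hA hk hy (by
    rw [ht, hy2]; exact pathCoord_center_det g p.2 p.1)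
  have hd : ∀ i r s u, pd modelN basisN (Sum.inr i)
      (sliceChristoffel modelN basisN (sliceCoord g m ro k A p) r s u) y
      = pd (𝓡 2) basisS i (christoffel (𝓡 2) basisS (pathCoord g p.2 p.1) r s u) y.2 :=
    fun i r s u => by
    rw [pd_inr_eq hy' (smoothIn_sliceChristoffel
      (smoothIn_sliceCoord hg hro hm hA.le hk hy) hdet hy' r s u).differentiableWithinAt]
    refine pd_congr ?_ (by simp)
    filter_upwards [extChartAt_target_mem_nhdsWithin_of_mem (mem_target_cylinder hy).2] with z hz
    have hz' : (y.1, z) ∈ (extChartAt modelN p).target := by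
      rw [extChartAt_cylinder]; exact ⟨(mem_target_cylinder hy).1, hz⟩
    rw [sliceChristoffel_collar hg hro hm hA hk hz']
    simp only [ht]
  simp only [sliceRiemann, riemann, hd, sliceChristoffel_collar hg hro hm hA hk hy, ht, hy2]
  rfl

lemma transDeriv_collar {p : N} {y : E₁ × E₂} (hy : y ∈ (extChartAt modelN p).target)
    (hy2 : y.2 = extChartAt (𝓡 2) p.2 p.2) (a c : Fin 2) :
    transDeriv modelN basisN (sliceCoord g m ro k A p) y a c
      = chartSign p.1 * ((1 / 2) * confLog m ro k A (chartTime p.1 y.1) *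
          conf m ro k A (chartTime p.1 y.1) * pathCoord g p.2 (chartTime p.1 y.1) y.2 a c
        + conf m ro k A (chartTime p.1 y.1) *
          gram basisS (fun v w : E₂ => velocity g (chartTime p.1 y.1) p.2 v w) a c) := by
  have ht := chartTime_mem hy
  refine pd_inl_eq (ψ := fun s => conf m ro k A s * pathCoord g p.2 s y.2 a c) hy
    (smoothIn_sliceCoord hg hro hm hA.le hk hy a c).differentiableWithinAt (fun z hz => rfl) ?_
  rw [hy2]
  exact (conf_hasDerivWithinAt hro hm hA.le hk ht).mul (pathCoord_hasDerivWithinAt hg p.2 ht a c)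

variable (htr : ∀ t ∈ Icc (0 : ℝ) 1, ∀ x : S2, traceVelocity g t x = 0)
include htr

omit hg hro hm hA hk in
lemma trace_center {p : N} {y : E₁ × E₂} (hy : y ∈ (extChartAt modelN p).target)
    (hy2 : y.2 = extChartAt (𝓡 2) p.2 p.2) :
    ∑ i, ∑ j, (pathCoord g p.2 (chartTime p.1 y.1) y.2)⁻¹ i j *
      gram basisS (fun v w : E₂ => velocity g (chartTime p.1 y.1) p.2 v w) i j = 0 := by
  rw [hy2, pathCoord_center]
  exact htr _ (chartTime_mem hy) p.2

/-- Only the conformal part contributes: tr_g g = 2 and tr_g g' = 0. The formula is stated along the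
whole line over the centre, so that it can be differentiated in t. -/
lemma transTrace_collar {p : N} {y : E₁ × E₂} (hy : y ∈ (extChartAt modelN p).target)
    (hy2 : y.2 = extChartAt (𝓡 2) p.2 p.2) :
    transTrace modelN basisN (sliceCoord g m ro k A p) y
      = chartSign p.1 * confLog m ro k A (chartTime p.1 y.1) := by
  have hc := (conf_pos hro hm hA.le hk (chartTime_mem hy).1).ne'
  have h := traceWrt_conformal (h := pathCoord g p.2 (chartTime p.1 y.1) y.2)
    (by rw [hy2]; exact pathCoord_center_det _ _ _) (pathCoord_symm _ _ _ _ _ _)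
    (trace_center htr hy hy2) (conf m ro k A (chartTime p.1 y.1))
    ((1 / 2) * confLog m ro k A (chartTime p.1 y.1))
  simp only [transTrace, transDeriv_collar hg hro hm hA hk hy hy2,
    sliceCoord_inv hro hm hA hk hy, Fin.sum_univ_two] at h ⊢
  field_simp
  field_simp at h
  linear_combination (chartSign p.1) * h

lemma pd_transTrace_collar (p : N) {w' : ℝ}
    (hw : HasDerivWithinAt (confLog m ro k A) w' (Icc 0 1) p.1) :
    pd modelN basisN (Sum.inl 0) (transTrace modelN basisN (sliceCoord g m ro k A p))
      (extChartAt modelN p p) = w' := by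
  set y := extChartAt modelN p p
  have hy : y ∈ (extChartAt modelN p).target := mem_extChartAt_target p
  have hy' : y ∈ range modelN := extChartAt_target_subset_range p hy
  have ht : chartTime p.1 y.1 = p.1 := chartTime_center p
  have hy2 : y.2 = extChartAt (𝓡 2) p.2 p.2 := snd_center p
  have hdet := sliceCoord_det_ne_zero hro hm hA hk hy (by
    rw [ht, hy2]; exact pathCoord_center_det g p.2 p.1)
  have hP := fun a c => smoothIn_sliceCoord hg hro hm hA.le hk hy a c
  have hdiff : DifferentiableWithinAt ℝ
      (transTrace modelN basisN (sliceCoord g m ro k A p)) (range modelN) y :=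
    DifferentiableWithinAt.fun_sum fun a _ => DifferentiableWithinAt.fun_sum fun c _ =>
      (SmoothIn.inv_entry hP hdet a c).differentiableWithinAt.fun_mul
        ((hP a c).pd hy').differentiableWithinAt
  rw [pd_inl_eq (ψ := fun t => chartSign p.1 * confLog m ro k A t) (ψ' := chartSign p.1 * w') hy
    hdiff (fun z hz => ?_) (by rw [ht]; exact hw.const_mul _), ← mul_assoc, chartSign_sq, one_mul]
  have hz' : (z, y.2) ∈ (extChartAt modelN p).target := by
    rw [extChartAt_cylinder]; exact ⟨hz, (mem_target_cylinder hy).2⟩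
  exact transTrace_collar hg hro hm hA hk htr hz' hy2

/-- The conformal part of P' is orthogonal to the trace free g', and |g|²_g = 2. -/
lemma transNormSq_collar (p : N) :
    transNormSq modelN basisN (sliceCoord g m ro k A p) (extChartAt modelN p p)
      = (1 / 2) * confLog m ro k A p.1 ^ 2 + normSqVelocity g p.1 p.2 := by
  set y := extChartAt modelN p p
  have hy : y ∈ (extChartAt modelN p).target := mem_extChartAt_target p
  have ht : chartTime p.1 y.1 = p.1 := chartTime_center p
  have hy2 : y.2 = extChartAt (𝓡 2) p.2 p.2 := snd_center p
  have hc := (conf_pos hro hm hA.le hk (chartTime_mem hy).1).ne'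
  have hn : normSqVelocity g p.1 p.2 = ∑ i, ∑ j, ∑ k, ∑ l,
      (pathCoord g p.2 p.1 (extChartAt (𝓡 2) p.2 p.2))⁻¹ i k *
      (pathCoord g p.2 p.1 (extChartAt (𝓡 2) p.2 p.2))⁻¹ j l *
      gram basisS (fun v w : E₂ => velocity g p.1 p.2 v w) i j *
      gram basisS (fun v w : E₂ => velocity g p.1 p.2 v w) k l := by
    rw [pathCoord_center]; rfl
  have hv : gram basisS (fun v w : E₂ => velocity g p.1 p.2 v w) 1 0
      = gram basisS (fun v w : E₂ => velocity g p.1 p.2 v w) 0 1 := by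
    change velocity g p.1 p.2 (basisS 1) (basisS 0) = velocity g p.1 p.2 (basisS 0) (basisS 1)
    unfold velocity
    congr 1
    funext s
    exact (g s).symm _ _ _
  have h0 := trace_center htr hy hy2
  have h1 := transDeriv_collar hg hro hm hA hk hy hy2
  have h2 := sliceCoord_inv (g := g) hro hm hA hk hy
  rw [ht] at h0 h1 h2 hc
  rw [hy2] at h0 h1 h2
  have h := normSqWrt_conformal (pathCoord_center_det _ _ _) (pathCoord_symm _ _ _ _ _ _) hv h0
    ((1 / 2) * confLog m ro k A p.1)
  rw [hn]
  have hσ := chartSign_sq p.1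
  have e : transNormSq modelN basisN (sliceCoord g m ro k A p) y =
      (chartSign p.1 * chartSign p.1) * ∑ i, ∑ j, ∑ r, ∑ l,
      (pathCoord g p.2 p.1 (extChartAt (𝓡 2) p.2 p.2))⁻¹ i r *
      (pathCoord g p.2 p.1 (extChartAt (𝓡 2) p.2 p.2))⁻¹ j l *
      ((1 / 2) * confLog m ro k A p.1 * pathCoord g p.2 p.1 (extChartAt (𝓡 2) p.2 p.2) i j +
        gram basisS (fun v w : E₂ => velocity g p.1 p.2 v w) i j) *
      ((1 / 2) * confLog m ro k A p.1 * pathCoord g p.2 p.1 (extChartAt (𝓡 2) p.2 p.2) r l +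
        gram basisS (fun v w : E₂ => velocity g p.1 p.2 v w) r l) := by
    unfold transNormSq
    simp only [Finset.mul_sum]
    refine Finset.sum_congr rfl fun i _ => Finset.sum_congr rfl fun j _ =>
      Finset.sum_congr rfl fun r _ => Finset.sum_congr rfl fun l _ => ?_
    rw [h1, h1, h2, h2]
    field_simp
  rw [e, hσ, one_mul, h]
  ring

/-- The scalar curvature of the collar metric. -/
lemma scalarCurvature_collar {γ : CylinderForm} (hγ : γ = collarForm g m ro k A) (p : N) :
    scalarCurvature modelN basisN γ p
      = 2 / uProfile m ro (A * k * p.1) ^ 2 *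
        (ro ^ 2 * gaussCurvature (𝓡 2) basisS (sphereForm (g p.1)) p.2 - k ^ 2
          - uProfile m ro (A * k * p.1) ^ 2 / (8 * A ^ 2) * normSqVelocity g p.1 p.2) := by
  set y := extChartAt modelN p p with hydef
  have hy : y ∈ (extChartAt modelN p).target := mem_extChartAt_target p
  have hy' : y ∈ range modelN := extChartAt_target_subset_range p hy
  have ht : chartTime p.1 y.1 = p.1 := chartTime_center p
  have hy2 : y.2 = extChartAt (𝓡 2) p.2 p.2 := snd_center p
  have hdet := sliceCoord_det_ne_zero hro hm hA hk hy (by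
    rw [ht, hy2]; exact pathCoord_center_det g p.2 p.1)
  have hP := fun a c => smoothIn_sliceCoord hg hro hm hA.le hk hy a c
  have hG := coordMetric_collar_eventuallyEq hγ p
  have hsymm : ∀ z a c, sliceCoord g m ro k A p z a c = sliceCoord g m ro k A p z c a :=
    fun z a c => by simp only [sliceCoord, Matrix.of_apply, pathCoord_symm _ _ _ _ a c]
  have h1 := sum_riemann_block (b := basisN) hA.ne' hP hdet hy' hsymm
  have h2 := sum_riemann_eq_two_mul (b := basisS)
    (smoothIn_pathCoord hg p.2 p.1.2 (mem_extChartAt_target p.2)) (pathCoord_center_det _ _ _)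
    (by simp) (fun z => pathCoord_symm g p.2 p.1 z)
  have hs : 0 ≤ A * k * p.1 := mul_nonneg (mul_nonneg hA.le hk) p.1.2.1
  have hug := uProfile_ge hro hm hs
  have hu := hro.trans_le hug
  have hsp : uSpeed m ro (A * k * p.1) ^ 2 = 1 - 2 * m / uProfile m ro (A * k * p.1) :=
    Real.sq_sqrt (one_sub_nonneg hro hm hug)
  have hK : gaussCurvature (𝓡 2) basisS (sphereForm (g p.1)) p.2
      = (∑ l, pathCoord g p.2 p.1 (extChartAt (𝓡 2) p.2 p.2) l 0 *
        riemann (𝓡 2) basisS (pathCoord g p.2 p.1) 0 1 1 l (extChartAt (𝓡 2) p.2 p.2)) /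
        (pathCoord g p.2 p.1 (extChartAt (𝓡 2) p.2 p.2) 0 0 *
          pathCoord g p.2 p.1 (extChartAt (𝓡 2) p.2 p.2) 1 1 -
          pathCoord g p.2 p.1 (extChartAt (𝓡 2) p.2 p.2) 0 1 ^ 2) := rfl
  rw [← hK] at h2
  have h3 : scalarCurvature modelN basisN γ p = ∑ j, ∑ l,
      (blockMetric A (sliceCoord g m ro k A p) y)⁻¹ j l *
      ∑ i, riemann modelN basisN (blockMetric A (sliceCoord g m ro k A p)) i j l i y := by
    simp only [scalarCurvature, riemann_congr hG hy', hG.self_of_nhdsWithin hy']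
    rfl
  have h4 : ∑ j, ∑ l, (sliceCoord g m ro k A p y)⁻¹ j l *
      ∑ i, sliceRiemann modelN basisN (sliceCoord g m ro k A p) i j l i y
      = (conf m ro k A p.1)⁻¹ * (2 * gaussCurvature (𝓡 2) basisS (sphereForm (g p.1)) p.2) := by
    rw [← h2]
    simp only [sliceRiemann_collar hg hro hm hA hk, y, sliceCoord_inv hro hm hA hk
      (mem_extChartAt_target p), chartTime_center, snd_center, Finset.mul_sum, mul_assoc]
    rfl
  rw [h3, h1, h4, pd_transTrace_collar hg hro hm hA hk htr p
    (confLog_hasDerivWithinAt hro hm hA.le hk p.1.2), transNormSq_collar hg hro hm hA hk htr p,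
    transTrace_collar hg hro hm hA hk htr hy hy2, ht, mul_pow (chartSign p.1),
    pow_two (chartSign p.1), chartSign_sq, one_mul, conf, confLog]
  -- Solving v² = 1 - 2m/u for m leaves an identity in u and v, in which all powers of v cancel and
  -- only k² survives.
  have hmu : m = (1 - uSpeed m ro (A * k * p.1) ^ 2) * uProfile m ro (A * k * p.1) / 2 := by
    rw [hsp]; field_simp; ring
  generalize uSpeed m ro (A * k * p.1) = v at hmu ⊢
  generalize uProfile m ro (A * k * p.1) = u at hu hmu ⊢
  have hu0 := hu.ne'
  have hA0 := hA.ne'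
  have hr0 := hro.ne'
  have hmu' : m / u = (1 - v ^ 2) / 2 := by rw [hmu]; field_simp
  rw [hmu']
  field_simp
  ring

end CollarCurvature

/-! ### Mean curvature of the slices -/

section SliceMeanCurvature

open Filter Topology

variable {g : ℝ → SphereMetric} {m ro k A : ℝ}

lemma pd_timeFn {p : N} {y : E₁ × E₂} (hy : y ∈ (extChartAt modelN p).target)
    (i : Fin 1 ⊕ Fin 2) :
    pd modelN basisN i (fun z => timeFn ((extChartAt modelN p).symm z)) y
      = chartSign p.1 * (basisN i).1 0 := by
  have hr : y ∈ range modelN := extChartAt_target_subset_range p hy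
  have h2 : (fun z => timeFn ((extChartAt modelN p).symm z)) =ᶠ[𝓝[range modelN] y]
      fun y => chartTime p.1 y.1 := by
    filter_upwards [extChartAt_target_mem_nhdsWithin_of_mem hy] with z hz using coe_fst_symm hz
  have h3 : HasFDerivWithinAt (fun y : E₁ × E₂ => chartTime p.1 y.1)
      ((chartSign p.1 • (EuclideanSpace.proj 0 : E₁ →L[ℝ] ℝ)).comp
        (ContinuousLinearMap.fst ℝ E₁ E₂)) (range modelN) y :=
    ((chartTime_hasFDerivAt p.1 y.1).comp y hasFDerivAt_fst).hasFDerivWithinAt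
  rw [pd_congr h2 hr, pd, h3.fderivWithin (modelN.uniqueDiffOn y hr)]
  rfl

lemma pd_timeFn_inl {p : N} {y : E₁ × E₂} (hy : y ∈ (extChartAt modelN p).target) :
    pd modelN basisN (Sum.inl 0) (fun z => timeFn ((extChartAt modelN p).symm z)) y
      = chartSign p.1 := by
  rw [pd_timeFn hy, basisN_inl]; simp

lemma pd_timeFn_inr {p : N} {y : E₁ × E₂} (hy : y ∈ (extChartAt modelN p).target) (a : Fin 2) :
    pd modelN basisN (Sum.inr a) (fun z => timeFn ((extChartAt modelN p).symm z)) y = 0 := by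
  rw [pd_timeFn hy, basisN_inr]; simp

variable {γ : CylinderForm}

/-! ### Gradient of t and unit normal -/

section

variable (hγ : γ = collarForm g m ro k A) (hA : 0 < A) {p : N} {y : E₁ × E₂}
  (hy : y ∈ (extChartAt modelN p).target) (hdet : (sliceCoord g m ro k A p y).det ≠ 0)
include hγ hA hy hdet

lemma gradTime_inl : gradTime γ p (Sum.inl 0) y = (A ^ 2)⁻¹ * chartSign p.1 := by
  simp only [gradTime, coordMetric_collar hγ hy, blockMetric_inv hA.ne' hdet,
    Fintype.sum_sum_type, Fin.sum_univ_one, pd_timeFn_inl hy, pd_timeFn_inr hy]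
  simp

lemma gradTime_inr (a : Fin 2) : gradTime γ p (Sum.inr a) y = 0 := by
  simp only [gradTime, coordMetric_collar hγ hy, blockMetric_inv hA.ne' hdet,
    Fintype.sum_sum_type, Fin.sum_univ_one, pd_timeFn_inl hy, pd_timeFn_inr hy]
  simp

lemma unitNormal_inr (a : Fin 2) : unitNormal γ p (Sum.inr a) y = 0 := by
  simp only [unitNormal, gradTime_inr hγ hA hy hdet, zero_div]

/-- The gradient of t has length 1/A. The normal thus has constant components in the chart, and its
coordinate derivatives along the slice vanish. -/
lemma unitNormal_inl : unitNormal γ p (Sum.inl 0) y = chartSign p.1 / A := by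
  have h : Real.sqrt (A ^ 2 * ((A ^ 2)⁻¹ * chartSign p.1) * ((A ^ 2)⁻¹ * chartSign p.1))
      = A⁻¹ := by
    rw [← Real.sqrt_sq (inv_pos.2 hA).le]
    congr 1
    have hσ := chartSign_sq p.1
    field_simp
    linear_combination hσ
  have h' : ∑ r, ∑ l, coordMetric modelN basisN γ p y r l * gradTime γ p r y * gradTime γ p l y
      = A ^ 2 * ((A ^ 2)⁻¹ * chartSign p.1) * ((A ^ 2)⁻¹ * chartSign p.1) := by
    simp only [Fintype.sum_sum_type, Fin.sum_univ_one, gradTime_inr hγ hA hy hdet,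
      gradTime_inl hγ hA hy hdet, coordMetric_collar hγ hy]
    simp [blockMetric]
  rw [unitNormal, h', h, gradTime_inl hγ hA hy hdet]
  field_simp

end

variable (hg : IsSmoothPath g) (hro : 0 < ro) (hm : m ≤ ro / 2) (hA : 0 < A) (hk : 0 ≤ k)
  (htr : ∀ t ∈ Icc (0 : ℝ) 1, ∀ x : S2, traceVelocity g t x = 0)
include hg hro hm hA hk

/-- With ν constant in coordinates only the Christoffel term ½ P⁻¹P' remains; lowering its index
gives P' / (2A), up to the chart's sign. -/
lemma secondFundamentalForm_collar (hγ : γ = collarForm g m ro k A) (p : N) (a c : Fin 2) :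
    secondFundamentalForm γ p a c = chartSign p.1 / (2 * A) *
      transDeriv modelN basisN (sliceCoord g m ro k A p) (extChartAt modelN p p) a c := by
  set y := extChartAt modelN p p
  have hy : y ∈ (extChartAt modelN p).target := mem_extChartAt_target p
  have hy' : y ∈ range modelN := extChartAt_target_subset_range p hy
  have hdet : (sliceCoord g m ro k A p y).det ≠ 0 :=
    sliceCoord_det_ne_zero hro hm hA hk hy (by
      rw [chartTime_center, snd_center]; exact pathCoord_center_det g p.2 p.1)
  have hP := fun a c => smoothIn_sliceCoord hg hro hm hA.le hk hy a c
  have hsymm : ∀ z a c, sliceCoord g m ro k A p z a c = sliceCoord g m ro k A p z c a :=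
    fun z a c => by simp only [sliceCoord, Matrix.of_apply, pathCoord_symm _ _ _ _ a c]
  have hG := coordMetric_collar_eventuallyEq hγ p
  have hΓ : ∀ i r s, christoffel modelN basisN (coordMetric modelN basisN γ p) i r s y
      = christoffel modelN basisN (blockMetric A (sliceCoord g m ro k A p)) i r s y :=
    fun i r s => (christoffel_eventuallyEq (b := basisN) hG i r s).self_of_nhdsWithin hy'
  have hev : ∀ᶠ z in 𝓝[range modelN] y, z ∈ (extChartAt modelN p).target ∧
      (sliceCoord g m ro k A p z).det ≠ 0 :=
    Filter.Eventually.and (extChartAt_target_mem_nhdsWithin_of_mem hy)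
      (SmoothIn.eventually_det_ne_zero hP hdet)
  have h1 : pd modelN basisN (Sum.inr a) (unitNormal γ p (Sum.inl 0)) y = 0 := by
    rw [pd_congr (hev.mono fun z hz => unitNormal_inl hγ hA hz.1 hz.2) hy', pd_const]
  have h2 : ∀ d, pd modelN basisN (Sum.inr a) (unitNormal γ p (Sum.inr d)) y = 0 := fun d => by
    rw [pd_congr (hev.mono fun z hz => unitNormal_inr hγ hA hz.1 hz.2 d) hy', pd_const]
  have hsh : ∑ d, sliceCoord g m ro k A p y d c * shape modelN basisN (sliceCoord g m ro k A p) d a y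
      = (1 / 2) * transDeriv modelN basisN (sliceCoord g m ro k A p) y a c := by
    have h := congrFun₂ (Matrix.mul_nonsing_inv_cancel_left (sliceCoord g m ro k A p y)
      (transDeriv modelN basisN (sliceCoord g m ro k A p) y) hdet.isUnit) c a
    rw [transDeriv_symm hsymm, ← h]
    simp only [Matrix.mul_apply, shape, hsymm y _ c, Finset.mul_sum]
    exact Finset.sum_congr rfl fun _ _ => Finset.sum_congr rfl fun _ _ => by ring
  have h3 : secondFundamentalForm γ p a c = ∑ d, sliceCoord g m ro k A p y d c *
      (shape modelN basisN (sliceCoord g m ro k A p) d a y * (chartSign p.1 / A)) := by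
    change ∑ i, coordMetric modelN basisN γ p y i (Sum.inr c) *
      (pd modelN basisN (Sum.inr a) (unitNormal γ p i) y
        + ∑ j, christoffel modelN basisN (coordMetric modelN basisN γ p) i (Sum.inr a) j y
          * unitNormal γ p j y) = _
    simp only [hΓ, coordMetric_collar hγ hy, Fintype.sum_sum_type, Fin.sum_univ_one, h1, h2,
      unitNormal_inl hγ hA hy hdet, unitNormal_inr hγ hA hy hdet,
      christoffel_block_abt hA.ne' hdet hsymm]
    simp [blockMetric]
  rw [h3]
  simp only [← mul_assoc, ← Finset.sum_mul, hsh]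
  field_simp

include htr

/-- The slices of the collar metric have constant mean curvature. -/
lemma meanCurvature_collar (hγ : γ = collarForm g m ro k A) (p : N) :
    meanCurvature γ p
      = 2 * k * uSpeed m ro (A * k * p.1) / uProfile m ro (A * k * p.1) := by
  set y := extChartAt modelN p p
  have hy : y ∈ (extChartAt modelN p).target := mem_extChartAt_target p
  have hG : (coordMetric modelN basisN γ p y).submatrix Sum.inr Sum.inr
      = sliceCoord g m ro k A p y := by
    rw [coordMetric_collar hγ hy]; rfl
  have h := transTrace_collar hg hro hm hA hk htr hy (snd_center p)
  have h1 : meanCurvature γ p = chartSign p.1 / (2 * A) *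
      transTrace modelN basisN (sliceCoord g m ro k A p) y := by
    change ∑ a, ∑ c, ((coordMetric modelN basisN γ p y).submatrix Sum.inr Sum.inr)⁻¹ a c *
      secondFundamentalForm γ p a c = _
    rw [hG]
    simp only [secondFundamentalForm_collar hg hro hm hA hk hγ, transTrace, Finset.mul_sum]
    exact Finset.sum_congr rfl fun _ _ => Finset.sum_congr rfl fun _ _ => by ring
  have hσ := chartSign_sq p.1
  rw [h1, h, chartTime_center, confLog]
  field_simp
  linear_combination 4 * k * uSpeed m ro (A * k * p.1) / uProfile m ro (A * k * p.1) * hσ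

end SliceMeanCurvature

/-! ### Area and Hawking mass of the slices -/

section SliceArea

variable {g : ℝ → SphereMetric} {m ro k A : ℝ} {γ : CylinderForm}

lemma inducedForm_collar (hγ : γ = collarForm g m ro k A) (t : Icc (0 : ℝ) 1) (x : S2)
    (v w : E₂) : inducedForm γ t x v w
      = conf m ro k A t * ((g t).inner x : E₂ →L[ℝ] E₂ →L[ℝ] ℝ) v w := by
  subst hγ
  have h : ∀ u : E₂, (mfderiv (𝓡 2) modelN (fun x : S2 => ((t, x) : N)) x u : E₁ × E₂) = (0, u) :=
    fun u => by rw [mfderiv_prod_right]; rfl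
  refine (collarForm_apply (t, x) _ _).trans ?_
  simp only [h]
  simp

/-- A path of metrics with trace free derivative has a constant area density. -/
lemma gram_det_const (hg : IsSmoothPath g)
    (htr : ∀ t ∈ Icc (0 : ℝ) 1, ∀ x : S2, traceVelocity g t x = 0) (x : S2) {t : ℝ}
    (ht : t ∈ Icc (0 : ℝ) 1) :
    (gram basisS (fun v w : E₂ => (g t).inner x v w)).det
      = (gram basisS (fun v w : E₂ => (g 0).inner x v w)).det := by
  have hd : ∀ s ∈ Icc (0 : ℝ) 1, HasDerivWithinAt
      (fun s => (pathCoord g x s (extChartAt (𝓡 2) x x)).det) 0 (Icc 0 1) s := fun s hs => by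
    have hp := pathCoord_hasDerivWithinAt hg x hs
    -- Jacobi's formula: (det P)' = det P · tr(P⁻¹ P'), which vanishes by the trace condition.
    have h := ((hp 0 0).mul (hp 1 1)).sub ((hp 0 1).mul (hp 1 0))
    have htr' : ∑ i, ∑ j, (pathCoord g x s (extChartAt (𝓡 2) x x))⁻¹ i j *
        gram basisS (fun v w : E₂ => velocity g s x v w) i j = 0 := by
      rw [pathCoord_center]; exact htr s hs x
    have hdet := inv_mul_cancel₀ (pathCoord_center_det g x s)
    have hsy := pathCoord_symm g x s (extChartAt (𝓡 2) x x) 1 0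
    simp only [Matrix.det_fin_two]
    refine h.congr_deriv ?_
    generalize gram basisS (fun v w : E₂ => velocity g s x v w) = V at htr'
    generalize pathCoord g x s (extChartAt (𝓡 2) x x) = P at htr' hdet hsy
    simp only [Matrix.inv_def, Matrix.adjugate_fin_two, Fin.sum_univ_two,
      Matrix.smul_apply, smul_eq_mul, Ring.inverse_eq_inv', Matrix.of_apply,
      Matrix.cons_val_zero, Matrix.cons_val_one, Matrix.cons_val'] at htr'
    linear_combination P.det * htr' - (P 1 1 * V 0 0 - P 0 1 * V 0 1 - P 1 0 * V 1 0
      + P 0 0 * V 1 1) * hdet + (V 1 0 - V 0 1) * hsy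
  have h := constant_of_derivWithin_zero (fun s hs => (hd s hs).differentiableWithinAt)
    (fun s hs => (hd s (Ico_subset_Icc_self hs)).derivWithin
      (uniqueDiffOn_Icc zero_lt_one s (Ico_subset_Icc_self hs))) t ht
  simpa only [pathCoord_center] using h

variable (hg : IsSmoothPath g) (hro : 0 < ro) (hm : m ≤ ro / 2) (hA : 0 < A) (hk : 0 ≤ k)
  (htr : ∀ t ∈ Icc (0 : ℝ) 1, ∀ x : S2, traceVelocity g t x = 0)
include hg hro hm hA hk htr

/-- In dimension two a conformal factor c multiplies √det by c, and the density of g(t) itself does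
not move. -/
lemma areaMeasure_collar (hγ : γ = collarForm g m ro k A) (t : Icc (0 : ℝ) 1) :
    areaMeasure (inducedForm γ t)
      = ENNReal.ofReal (conf m ro k A t) • areaMeasure (sphereForm (g 0)) := by
  have hc := conf_pos hro hm hA.le hk t.2.1
  unfold areaMeasure
  rw [← withDensity_smul' _ _ ENNReal.ofReal_ne_top]
  congr 1
  funext x
  have e : gram basisS (fun v w : E₂ => inducedForm γ t x v w)
      = conf m ro k A t • gram basisS (fun v w : E₂ => (g t).inner x v w) := by
    ext a c
    exact inducedForm_collar hγ t x _ _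
  rw [e, Matrix.det_smul, gram_det_const hg htr x t.2, Pi.smul_apply, smul_eq_mul,
    ← ENNReal.ofReal_mul hc.le, Fintype.card_fin, mul_div_assoc, Real.sqrt_mul (sq_nonneg _),
    Real.sqrt_sq hc.le]

lemma area_collar (hγ : γ = collarForm g m ro k A) (har : ro = areaRadius (sphereForm (g 0)))
    (t : Icc (0 : ℝ) 1) :
    area (inducedForm γ t) = 4 * Real.pi * uProfile m ro (A * k * t) ^ 2 := by
  have hc := conf_pos hro hm hA.le hk t.2.1
  have h0 : area (sphereForm (g 0)) = 4 * Real.pi * ro ^ 2 := by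
    have h1 : 0 ≤ area (sphereForm (g 0)) / (4 * Real.pi) :=
      div_nonneg measureReal_nonneg (by positivity)
    rw [har, areaRadius, Real.sq_sqrt h1]
    field_simp
  unfold area at h0 ⊢
  rw [areaMeasure_collar hg hro hm hA hk htr hγ, measureReal_ennreal_smul_apply,
    ENNReal.toReal_ofReal hc.le, h0, conf]
  field_simp

/-- With |Σ_t| = 4πu² and H = 2kv/u the mass is ½u (1 - k²v²); substituting v² = 1 - 2m/u makes it
affine in u. -/
lemma hawkingMass_collar (hγ : γ = collarForm g m ro k A)
    (har : ro = areaRadius (sphereForm (g 0))) (t : Icc (0 : ℝ) 1) :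
    hawkingMass γ t = (1 / 2) * uProfile m ro (A * k * t) * (1 - k ^ 2) + k ^ 2 * m := by
  have hs : 0 ≤ A * k * t := mul_nonneg (mul_nonneg hA.le hk) t.2.1
  have hug := uProfile_ge hro hm hs
  have hu := hro.trans_le hug
  have hsp : uSpeed m ro (A * k * t) ^ 2 = 1 - 2 * m / uProfile m ro (A * k * t) :=
    Real.sq_sqrt (one_sub_nonneg hro hm hug)
  have har' := area_collar hg hro hm hA hk htr hγ har t
  have hsqrt : Real.sqrt (area (inducedForm γ t) / (16 * Real.pi))
      = uProfile m ro (A * k * t) / 2 := by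
    rw [har', ← Real.sqrt_sq (half_pos hu).le]
    congr 1
    field_simp
    ring
  have hint : ∫ x, meanCurvature γ (t, x) ^ 2 ∂(areaMeasure (inducedForm γ t))
      = area (inducedForm γ t) *
        (2 * k * uSpeed m ro (A * k * t) / uProfile m ro (A * k * t)) ^ 2 := by
    simp only [meanCurvature_collar hg hro hm hA hk htr hγ, integral_const, smul_eq_mul]
    rfl
  rw [hawkingMass, hsqrt, hint, har', div_pow, mul_pow, hsp]
  field_simp
  ring

end SliceArea

/-! ### The scalar curvature estimate -/

section Threshold

variable {α β ro m k A : ℝ}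

lemma threshold_pos (hro : 0 < ro) (hα : 0 < α)
    (hneg : m < 0 → 0 < β - (1 + (1 - 2 * m / ro) * α) * k ^ 2)
    (hnonneg : 0 ≤ m → 0 < β - (1 + α) * k ^ 2) : 0 < thresholdA α β ro m k := by
  unfold thresholdA
  split_ifs with h
  · exact mul_pos hro (Real.sqrt_pos.2 (div_pos hα (hneg h)))
  · exact mul_pos hro (Real.sqrt_pos.2 (div_pos hα (hnonneg (not_lt.1 h))))

lemma sq_le_of_mul_sqrt_le {D : ℝ} (hro : 0 < ro) (hα : 0 < α) (hD : 0 < D)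
    (h : ro * Real.sqrt (α / D) ≤ A) : α * (ro ^ 2 / A ^ 2) ≤ D := by
  have h0 : 0 < ro * Real.sqrt (α / D) := mul_pos hro (Real.sqrt_pos.2 (div_pos hα hD))
  have hA := h0.trans_le h
  have h1 : (ro * Real.sqrt (α / D)) ^ 2 ≤ A ^ 2 := pow_le_pow_left₀ h0.le h 2
  rw [mul_pow, Real.sq_sqrt (div_pos hα hD).le, ← mul_div_assoc, div_le_iff₀ hD] at h1
  rw [← mul_div_assoc, div_le_iff₀ (by positivity)]
  linarith

/-- The size of the collar parameter that makes the curvature of the slices dominate. -/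
lemma threshold_estimate (hro : 0 < ro) (hα : 0 < α)
    (hneg : m < 0 → 0 < β - (1 + (1 - 2 * m / ro) * α) * k ^ 2)
    (hnonneg : 0 ≤ m → 0 < β - (1 + α) * k ^ 2) (hA : thresholdA α β ro m k ≤ A) :
    α * (ro ^ 2 / A ^ 2 + slopeBound m ro ^ 2 * k ^ 2) ≤ β - k ^ 2 := by
  unfold thresholdA at hA
  unfold slopeBound
  split_ifs at hA ⊢ with h
  · have h1 := sq_le_of_mul_sqrt_le hro hα (hneg h) hA
    have h2 : 0 ≤ 1 - 2 * m / ro := by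
      have : m / ro < 0 := div_neg_of_neg_of_pos h hro
      have e : 2 * m / ro = 2 * (m / ro) := by ring
      rw [e]; linarith
    rw [Real.sq_sqrt h2]
    linarith
  · have h1 := sq_le_of_mul_sqrt_le hro hα (hnonneg (not_lt.1 h)) hA
    linarith

/-- The reaction of the slices to the motion of the path of metrics is controlled by the
curvature. -/
lemma curvature_estimate (hro : 0 < ro) (hm : m ≤ ro / 2) (hα : 0 < α) (hA0 : 0 < A) (hk : 0 ≤ k)
    (hest : α * (ro ^ 2 / A ^ 2 + slopeBound m ro ^ 2 * k ^ 2) ≤ β - k ^ 2)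
    {t K n : ℝ} (ht : t ∈ Icc (0 : ℝ) 1) (hK : β ≤ ro ^ 2 * K) (hn : 1 / 4 * n ≤ α) :
    0 ≤ ro ^ 2 * K - k ^ 2 - uProfile m ro (A * k * t) ^ 2 / (8 * A ^ 2) * n := by
  have hAk : 0 ≤ A * k := mul_nonneg hA0.le hk
  have hs : 0 ≤ A * k * t := mul_nonneg hAk ht.1
  have hu := hro.trans_le (uProfile_ge hro hm hs)
  have hL := slopeBound_pos (m := m) hro
  have hu1 : uProfile m ro (A * k * t) ≤ ro + slopeBound m ro * (A * k) :=
    (uProfile_le hro hm hs).trans (add_le_add_right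
      (mul_le_mul_of_nonneg_left (mul_le_of_le_one_right hAk ht.2) hL.le) _)
  -- (a + b)² ≤ 2a² + 2b² separates r_o from LAk; after division by A² the second term no longer
  -- depends on A, whence the closed form of A_o.
  have hu2 : uProfile m ro (A * k * t) ^ 2 ≤ 2 * ro ^ 2 + 2 * (slopeBound m ro * (A * k)) ^ 2 := by
    have := pow_le_pow_left₀ hu.le hu1 2
    nlinarith [sq_nonneg (ro - slopeBound m ro * (A * k))]
  have h1 : uProfile m ro (A * k * t) ^ 2 / (8 * A ^ 2) * n
      ≤ (2 * ro ^ 2 + 2 * (slopeBound m ro * (A * k)) ^ 2) / (8 * A ^ 2) * (4 * α) :=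
    (mul_le_mul_of_nonneg_left (by linarith) (by positivity)).trans
      (mul_le_mul_of_nonneg_right (by gcongr) (by positivity))
  have h2 : (2 * ro ^ 2 + 2 * (slopeBound m ro * (A * k)) ^ 2) / (8 * A ^ 2) * (4 * α)
      = α * (ro ^ 2 / A ^ 2 + slopeBound m ro ^ 2 * k ^ 2) := by
    field_simp
    ring
  linarith

end Threshold

/-! ### The bounds given by α and β, and positivity of r_o -/

section Extrema

variable {g : ℝ → SphereMetric} {ro : ℝ}

lemma pathBeta_le (hK : ∀ t ∈ Icc (0 : ℝ) 1, ∀ x : S2,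
    0 < gaussCurvature (𝓡 2) basisS (sphereForm (g t)) x) (p : N) :
    pathBeta g ro ≤ ro ^ 2 * gaussCurvature (𝓡 2) basisS (sphereForm (g p.1)) p.2 :=
  ciInf_le ⟨0, by
    rintro _ ⟨q, rfl⟩
    exact mul_nonneg (sq_nonneg _) (hK q.1 q.1.2 q.2).le⟩ p

/-- A real supremum over an unbounded family is 0 by convention, so α > 0 already forces boundedness
and no compactness argument is needed. -/
lemma le_pathAlpha (hα : 0 < pathAlpha g) (p : N) :
    1 / 4 * normSqVelocity g p.1 p.2 ≤ pathAlpha g :=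
  le_ciSup (f := fun p : N => 1 / 4 * normSqVelocity g p.1 p.2)
    (by_contra fun h => hα.ne' (Real.iSup_of_not_bddAbove h)) p

/-- If r_o were 0, then β would be the infimum of the zero function. Both threshold conditions, with
division by zero giving 0, would read 0 < -(1 + α)k². -/
lemma areaRadius_pos {α β m k : ℝ} (hro : ro = areaRadius (sphereForm (g 0)))
    (hβ : β = pathBeta g ro) (hα : 0 < α)
    (hneg : m < 0 → 0 < β - (1 + (1 - 2 * m / ro) * α) * k ^ 2)
    (hnonneg : 0 ≤ m → 0 < β - (1 + α) * k ^ 2) : 0 < ro := by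
  have h0 : 0 ≤ ro := hro ▸ Real.sqrt_nonneg _
  refine h0.lt_of_ne fun h => ?_
  subst h
  have hβ0 : β = 0 := by simp [hβ, pathBeta, Real.iInf_const_zero]
  have hk := mul_nonneg (add_pos one_pos hα).le (sq_nonneg k)
  rcases lt_or_ge m 0 with hm | hm
  · have := hneg hm
    simp only [div_zero, sub_zero, one_mul] at this
    linarith
  · linarith [hnonneg hm]

end Extrema

end Collar

end

/-! ### Proof of the theorem -/

open Collar in
theorem proposition2p1 (g : ℝ → SphereMetric) (hg : IsSmoothPath g)
    (hK : ∀ t ∈ Icc (0 : ℝ) 1, ∀ x : S2,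
      0 < gaussCurvature (𝓡 2) basisS (sphereForm (g t)) x)
    (htr : ∀ t ∈ Icc (0 : ℝ) 1, ∀ x : S2, traceVelocity g t x = 0)
    (ro β α : ℝ)
    (hro : ro = areaRadius (sphereForm (g 0)))
    (hβ : β = pathBeta g ro)
    (hα : α = pathAlpha g)
    (hα_pos : 0 < α)
    (m k : ℝ) (hm : m ≤ ro / 2) (hk : 0 ≤ k)
    (hneg : m < 0 → 0 < β - (1 + (1 - 2 * m / ro) * α) * k ^ 2)
    (hnonneg : 0 ≤ m → 0 < β - (1 + α) * k ^ 2)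
    (A : ℝ) (hA : thresholdA α β ro m k ≤ A) :
    ∃ γ : CylinderMetric,
      (∀ (p : N) (v w : TangentSpace modelN p), γ.inner p v w = collarForm g m ro k A p v w) ∧
      (∀ p : N, 0 ≤ scalarCurvature modelN basisN (cylinderForm γ) p) ∧
      (∀ (x : S2) (v w : TangentSpace (𝓡 2) x),
        inducedForm (cylinderForm γ) 0 x v w = (g 0).inner x v w) ∧
      (∀ x : S2, meanCurvature (cylinderForm γ) (0, x)
        = 2 * k * ro⁻¹ * Real.sqrt (1 - 2 * m / ro)) ∧
      (∀ t : Icc (0 : ℝ) 1, ∃ H : ℝ,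
        (∀ x : S2, meanCurvature (cylinderForm γ) (t, x) = H) ∧
        (0 < k → (m < ro / 2 ∨ 0 < (t : ℝ)) → 0 < H)) ∧
      (∀ t : Icc (0 : ℝ) 1, hawkingMass (cylinderForm γ) t
        = (1 / 2) * (uProfile m ro (A * k * (t : ℝ)) - ro) * (1 - k ^ 2)
          + hawkingMass (cylinderForm γ) 0) := by
  have hro0 : 0 < ro := areaRadius_pos hro hβ hα_pos hneg hnonneg
  have hA0 : 0 < A := (threshold_pos hro0 hα_pos hneg hnonneg).trans_le hA
  have hest := threshold_estimate hro0 hα_pos hneg hnonneg hA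
  have hinner : ∀ (p : N) (v w : TangentSpace modelN p),
      (collarMetric hg hro0 hm hA0 hk).inner p v w = collarForm g m ro k A p v w :=
    fun p v w => collarBilin_apply p v w
  have hγ : cylinderForm (collarMetric hg hro0 hm hA0 hk) = collarForm g m ro k A := by
    funext p v w; exact hinner p v w
  have hH := meanCurvature_collar hg hro0 hm hA0 hk htr hγ
  have h00 : A * k * ((0 : Icc (0 : ℝ) 1) : ℝ) = 0 := by simp
  refine ⟨collarMetric hg hro0 hm hA0 hk, hinner, fun p => ?_, fun x v w => ?_, fun x => ?_,
    fun t => ⟨2 * k * uSpeed m ro (A * k * t) / uProfile m ro (A * k * t),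
      fun x => hH (t, x), fun hk0 ht => ?_⟩, fun t => ?_⟩
  · rw [scalarCurvature_collar hg hro0 hm hA0 hk htr hγ p]
    refine mul_nonneg (by positivity) (curvature_estimate hro0 hm hα_pos hA0 hk hest p.1.2 ?_ ?_)
    · rw [hβ]; exact pathBeta_le hK p
    · subst hα; exact le_pathAlpha hα_pos p
  · refine (inducedForm_collar hγ 0 x v w).trans ?_
    rw [conf, h00, uProfile_zero hro0 hm, ← mul_pow, inv_mul_cancel₀ hro0.ne', one_pow, one_mul]
    rfl
  · rw [hH, h00, uSpeed, uProfile_zero hro0 hm]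
    ring
  · have hs : 0 ≤ A * k * t := mul_nonneg (mul_nonneg hA0.le hk) t.2.1
    have hu := uProfile_ge hro0 hm hs
    -- H > 0 requires v > 0, that is u > 2m: either 2m < r_o ≤ u, or u has already left r_o because
    -- Akt > 0.
    have hlt : 2 * m < uProfile m ro (A * k * t) := by
      rcases ht with ht | ht
      · linarith
      · have := uProfile_gt hro0 hm (mul_pos (mul_pos hA0 hk0) ht)
        linarith
    have hu0 := hro0.trans_le hu
    have hsp : 0 < uSpeed m ro (A * k * t) :=
      Real.sqrt_pos.2 (sub_pos.2 ((div_lt_one hu0).2 hlt))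
    exact div_pos (by positivity) hu0
  · rw [hawkingMass_collar hg hro0 hm hA0 hk htr hγ hro,
      hawkingMass_collar hg hro0 hm hA0 hk htr hγ hro, h00, uProfile_zero hro0 hm]
    ring
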